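/- Let $a>0$ and let $f_1,f_2\in L^1(\mathbb{R}^2)$ be complex-valued functions supported (almost everywhere) in the closed disk $\{x:|x|\le a/2\}$. Let $(f_1*f_2)(x)=\int_{\mathbb{R}^2}f_1(y)f_2(x-y)\,dy$. Let $m\in\mathbb{Z}$ and let $n\ge |m|$ be an integer with $n\equiv |m| \pmod 2$. Put $$Z_{nm}(r)=\sum_{j=0}^{(n-|m|)/2}(-1)^j\frac{(n-j)!}{j!\,\big(\frac{n+|m|}{2}-j\big)!\,\big(\frac{n-|m|}{2}-j\big)!}\,r^{n-2j},\qquad V^a_{nm}(r,\theta)=\frac1a\sqrt{\frac{n+1}{\pi}}\;Z_{nm}(r/a)\,e^{\mathrm{i}m\theta},$$ and, for a function $f$ on the plane, define its Fourier–Zernike coefficient and its Fourier coefficients on the square $[-a,a]^2$ by $$C^a_{n,m}(f)=\int_0^a\!\int_0^{2\pi}f(r\cos\theta,r\sin\theta)\,\overline{V^a_{nm}(r,\theta)}\;r\,d\theta\,dr,\qquad \widehat f(k)=\int_{-a}^a\!\int_{-a}^a f(x_1,x_2)\,e^{-\pi\mathrm{i}a^{-1}(k_1x_1+k_2x_2)}\,dx_1\,dx_2\quad(k\in\mathbb{Z}^2).$$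 For $k=(k_1,k_2)\in\mathbb{Z}^2$ let $|k|=\sqrt{k_1^2+k_2^2}$, let $\Phi(k)\in[0,2\pi)$ be the polar angle of $k$ (with $\Phi(0)=0$), let $J_q$ be the Bessel function of the first kind of order $q$, and put $$c_a(k;n,m)=\sqrt{n+1}\;\frac{\mathrm{i}^m(-1)^{\frac{n-m}{2}}J_{n+1}(\pi|k|)}{2a\sqrt{\pi}\,|k|}\;e^{-\mathrm{i}m\Phi(k)},$$ where for $k=0$ the quotient $J_{n+1}(\pi|k|)/|k|$ is replaced by its limit $\lim_{\rho\to0}J_{n+1}(\pi\rho)/\rho$, which is $\pi/2$ if $n=0$ and $0$ if $n\ge1$. Then $$C^a_{n,m}(f_1*f_2)=\sum_{k\in\mathbb{Z}^2}c_a(k;n,m)\,\widehat{f_1}(k)\,\widehat{f_2}(k),$$ where the series is the limit, as $N\to\infty$, of its square partial sums over $\{k:|k_1|\le N,\ |k_2|\le N\}$. If moreover $f_1*f_2\in L^2(\mathbb{R}^2)$ (in particular if $f_1$ or $f_2$ is in $L^2$), the series converges unconditionally (hence absolutely) to the same value. -/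

import Mathlib

/-- The closed disk of radius `r` about the origin of the Euclidean plane, written in coordinates
(the norm of `ℝ × ℝ` in Mathlib is the sup norm). -/
def disk (r : ℝ) : Set (ℝ × ℝ) := {x | x.1 ^ 2 + x.2 ^ 2 ≤ r ^ 2}

/-- Convolution on the plane: `(f₁ ∗ f₂)(x) = ∫ f₁(y) f₂(x - y) dy`, for Lebesgue measure. -/
noncomputable def planeConv (f₁ f₂ : ℝ × ℝ → ℂ) : ℝ × ℝ → ℂ :=
  MeasureTheory.convolution f₁ f₂ (ContinuousLinearMap.mul ℝ ℂ) MeasureTheory.volume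

/-- The Bessel function of the first kind `J_q` of integer order `q ≥ 0`. -/
noncomputable def besselJ (q : ℕ) (x : ℝ) : ℝ :=
  ∑' j : ℕ, (-1 : ℝ) ^ j / ((j.factorial : ℝ) * ((j + q).factorial : ℝ)) * (x / 2) ^ (2 * j + q)

/-- The radial Zernike polynomial `Z_{nm}`, for `|m| ≤ n` and `n - |m|` even. -/
noncomputable def zernikeRadial (n : ℕ) (m : ℤ) (r : ℝ) : ℝ :=
  ∑ j ∈ Finset.range ((n - m.natAbs) / 2 + 1),
    (-1 : ℝ) ^ j *
      (((n - j).factorial : ℝ) /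
        ((j.factorial : ℝ) * (((n + m.natAbs) / 2 - j).factorial : ℝ) *
          (((n - m.natAbs) / 2 - j).factorial : ℝ))) *
      r ^ (n - 2 * j)

/-- The Fourier–Zernike basis element `V_{nm}^a` in polar coordinates. -/
noncomputable def fourierZernike (a : ℝ) (n : ℕ) (m : ℤ) (r θ : ℝ) : ℂ :=
  ((a⁻¹ * Real.sqrt (((n : ℝ) + 1) / Real.pi) * zernikeRadial n m (a⁻¹ * r) : ℝ) : ℂ) *
    Complex.exp (Complex.I * (m : ℂ) * (θ : ℂ))

/-- The Fourier–Zernike coefficient `C_{n,m}^a(f)`. -/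
noncomputable def zernikeCoeff (a : ℝ) (n : ℕ) (m : ℤ) (f : ℝ × ℝ → ℂ) : ℂ :=
  ∫ r in (0 : ℝ)..a, ∫ θ in (0 : ℝ)..(2 * Real.pi),
    f (r * Real.cos θ, r * Real.sin θ) * starRingEnd ℂ (fourierZernike a n m r θ) * (r : ℂ)

/-- The (unnormalized) Fourier coefficient of `f` on the square `[-a, a]²`. -/
noncomputable def squareFourierCoeff (a : ℝ) (f : ℝ × ℝ → ℂ) (k : ℤ × ℤ) : ℂ :=
  ∫ x₂ in (-a)..a, ∫ x₁ in (-a)..a,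
    f (x₁, x₂) *
      Complex.exp (-((Real.pi : ℂ) * Complex.I * (a : ℂ)⁻¹ *
        ((k.1 : ℂ) * (x₁ : ℂ) + (k.2 : ℂ) * (x₂ : ℂ))))

/-- The Euclidean length `|k|`. -/
noncomputable def latticeNorm (k : ℤ × ℤ) : ℝ := Real.sqrt ((k.1 : ℝ) ^ 2 + (k.2 : ℝ) ^ 2)

/-- The polar angle `Φ(k) ∈ [0, 2π)` of `k` (with `Φ(0) = 0`). -/
noncomputable def latticeAngle (k : ℤ × ℤ) : ℝ :=
  toIcoMod Real.two_pi_pos 0 (Complex.arg ⟨(k.1 : ℝ), (k.2 : ℝ)⟩)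

/-- `J_{n+1}(πρ) / ρ`, continuously extended to `ρ = 0`: there the value is `π / 2` for `n = 0`
and `0` for `n ≥ 1`. -/
noncomputable def besselQuotient (n : ℕ) (ρ : ℝ) : ℝ :=
  if ρ = 0 then (if n = 0 then Real.pi / 2 else 0) else besselJ (n + 1) (Real.pi * ρ) / ρ

/-- The factor `c_a(k; n, m)`. In the exponent, `n - m` is even, so the division is exact. -/
noncomputable def convFactor (a : ℝ) (k : ℤ × ℤ) (n : ℕ) (m : ℤ) : ℂ :=
  (Real.sqrt ((n : ℝ) + 1) : ℂ) *
    (Complex.I ^ m * (-1 : ℂ) ^ (((n : ℤ) - m) / 2) * (besselQuotient n (latticeNorm k) : ℂ) /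
      (2 * (a : ℂ) * (Real.sqrt Real.pi : ℂ))) *
    Complex.exp (-(Complex.I * (m : ℂ) * (latticeAngle k : ℂ)))

/-- The lattice points of the square `[-N, N]²`. -/
noncomputable def latticeSquare (N : ℕ) : Finset (ℤ × ℤ) :=
  Finset.Icc (-(N : ℤ)) (N : ℤ) ×ˢ Finset.Icc (-(N : ℤ)) (N : ℤ)

/-! Let `G` be the conjugate of the Fourier–Zernike function, cut off to the disk of radius `a` and
extended by zero to the period square. The coefficient of `f` is the pairing of `f` with `G`. The
Jacobi–Anger expansion in the angle and the Hankel transform of the Zernike polynomial in the radius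
(`integral_exp_cos_mul_exp`, `integral_besselJ_mul_zernikeRadial`) show that the pairing of `G` with
the exponential monomial of frequency `k` is `4 a ^ 2` times `convFactor a k n m`. Hence the factors
are the Fourier coefficients of `G`.

For `f = f₁ ∗ f₂` the supports keep `f` inside the disk of radius `a`, and its Fourier coefficients
on the square are the products of those of `f₁` and `f₂`. So a square partial sum of the series
equals the integral of `f` against the square partial sum `S_N G`. When `f` is a trigonometric
polynomial this integral eventually equals the coefficient, by orthogonality. Trigonometric
polynomials are dense in `L¹`, so the limit follows for all integrable `f` once `S_N G` is bounded
uniformly in `N` and in the point (`exists_norm_sum_convFactor_le`).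

That bound is the hard part. `G` is a polynomial in Cartesian coordinates on the disk, so by scaling
it concerns a double Dirichlet integral of a monomial over the disk of radius `π`. By symmetry a
quadrant suffices; it is an inscribed square, where the integral factors, and two congruent circular
caps. On a cap (`exists_abs_integral_cap_le`) integration by parts in the first variable leaves
terms bounded in one dimension and one integral along the arc, of the primitive of one Dirichlet
kernel against the other kernel. The primitive is a step function `±π` up to an error. The step
pairs boundedly by a second integration by parts. The error is handled by Cauchy–Schwarz in the form
of a weighted mean inequality: with `L = 2 N + 1`, the square of the error has integral of order `1
/ L`, that of the kernel of order `L`.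

If `f` is square integrable, Bessel's inequality makes both coefficient sequences square summable,
so the series converges absolutely, and the square partial sums identify its sum. -/

open Real Set MeasureTheory intervalIntegral

/-! ### The Dirichlet kernel and its primitive. -/

/-- The Dirichlet kernel `1 + 2 ∑_{k=1}^N cos (k t)`. -/
noncomputable def dirichletKernel (N : ℕ) (t : ℝ) : ℝ :=
  1 + 2 * ∑ k ∈ Finset.range N, cos ((k + 1 : ℝ) * t)

/-- The primitive of the Dirichlet kernel that vanishes at `0`. -/
noncomputable def dirichletPrimitive (N : ℕ) (t : ℝ) : ℝ :=
  t + 2 * ∑ k ∈ Finset.range N, sin ((k + 1 : ℝ) * t) / (k + 1)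

theorem continuous_dirichletKernel (N : ℕ) : Continuous (dirichletKernel N) := by
  unfold dirichletKernel; fun_prop

theorem hasDerivAt_dirichletPrimitive (N : ℕ) (t : ℝ) :
    HasDerivAt (dirichletPrimitive N) (dirichletKernel N t) t := by
  unfold dirichletPrimitive dirichletKernel
  refine (hasDerivAt_id t).add (HasDerivAt.const_mul 2 (HasDerivAt.fun_sum fun k _ => ?_))
  have hk : (k + 1 : ℝ) ≠ 0 := by positivity
  have h := ((hasDerivAt_id t).const_mul (k + 1 : ℝ)).sin.div_const (k + 1 : ℝ)
  refine h.congr_deriv ?_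
  simp only [id]
  field_simp

theorem continuous_dirichletPrimitive (N : ℕ) : Continuous (dirichletPrimitive N) :=
  continuous_iff_continuousAt.2 fun t => (hasDerivAt_dirichletPrimitive N t).continuousAt

theorem dirichletKernel_neg (N : ℕ) (t : ℝ) : dirichletKernel N (-t) = dirichletKernel N t := by
  simp [dirichletKernel]

theorem dirichletPrimitive_neg (N : ℕ) (t : ℝ) :
    dirichletPrimitive N (-t) = -dirichletPrimitive N t := by
  simp only [dirichletPrimitive, mul_neg, sin_neg, neg_div, Finset.sum_neg_distrib]
  ring

theorem dirichletPrimitive_two_pi_sub (N : ℕ) (t : ℝ) :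
    dirichletPrimitive N (2 * π - t) = 2 * π - dirichletPrimitive N t := by
  have h : ∀ k : ℕ, sin ((k + 1 : ℝ) * (2 * π - t)) = -sin ((k + 1 : ℝ) * t) := fun k => by
    have := sin_nat_mul_two_pi_sub ((k + 1 : ℝ) * t) (k + 1)
    rw [← this]; push_cast; ring_nf
  simp only [dirichletPrimitive, h, neg_div, Finset.sum_neg_distrib]
  ring

theorem dirichletPrimitive_pi (N : ℕ) : dirichletPrimitive N π = π := by
  have h : ∀ k : ℕ, sin ((k + 1 : ℝ) * π) = 0 := fun k => by
    exact_mod_cast sin_nat_mul_pi (k + 1)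
  simp [dirichletPrimitive, h]

theorem dirichletKernel_mul_sin (N : ℕ) (t : ℝ) :
    dirichletKernel N t * sin (t / 2) = sin ((N + 1 / 2 : ℝ) * t) := by
  induction N with
  | zero => simp [dirichletKernel]; ring_nf
  | succ N ih =>
    have h : dirichletKernel (N + 1) t = dirichletKernel N t + 2 * cos ((N + 1 : ℝ) * t) := by
      simp only [dirichletKernel, Finset.sum_range_succ]; ring
    have e1 : ((N : ℝ) + 1 / 2) * t = (N + 1 : ℝ) * t - t / 2 := by ring
    have e2 : (((N + 1 : ℕ) : ℝ) + 1 / 2) * t = (N + 1 : ℝ) * t + t / 2 := by push_cast; ring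
    rw [h, add_mul, ih, e1, e2, sin_sub, sin_add]
    ring

theorem abs_dirichletPrimitive_le_mul (N : ℕ) {t : ℝ} (ht : 0 ≤ t) :
    |dirichletPrimitive N t| ≤ (2 * N + 1) * t := by
  have h : |∑ k ∈ Finset.range N, sin ((k + 1 : ℝ) * t) / (k + 1)| ≤ N * t := by
    refine (Finset.abs_sum_le_sum_abs _ _).trans ?_
    refine (Finset.sum_le_sum (g := fun _ => t) fun k _ => ?_).trans_eq (by simp)
    have hk : (0 : ℝ) < k + 1 := by positivity
    rw [abs_div, abs_of_pos hk, div_le_iff₀ hk]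
    refine (abs_sin_le_abs).trans_eq ?_
    rw [abs_of_nonneg (by positivity), mul_comm]
  unfold dirichletPrimitive
  refine (abs_add_le _ _).trans ?_
  rw [abs_mul, abs_of_nonneg ht, abs_two]
  linarith

/-- The kernel is `sin (l s) / sin (s / 2)` with `l = N + 1 / 2`, so its integral from `t` to `π`
gains a factor `1 / l` by partial integration. The argument runs through monotonicity: `E` is the
difference corrected by the boundary term, and its derivative is dominated by minus the derivative
of `1 / (l sin (s / 2))`. Adding or subtracting that function makes `E` monotone, and it is compared
with its value at `π`. -/
theorem abs_dirichletPrimitive_sub_pi_le (N : ℕ) {t : ℝ} (ht : 0 < t) (htπ : t ≤ π) :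
    |dirichletPrimitive N t - π| ≤ 4 / ((2 * N + 1) * sin (t / 2)) := by
  set l : ℝ := N + 1 / 2 with hl
  have hl0 : 0 < l := by positivity
  set E : ℝ → ℝ := fun s => dirichletPrimitive N s - π + cos (l * s) / (l * sin (s / 2)) with hE
  have hsin : ∀ s ∈ Icc t π, 0 < sin (s / 2) := fun s hs =>
    sin_pos_of_pos_of_lt_pi (by linarith [hs.1]) (by linarith [hs.2, pi_pos])
  have hcos : ∀ s ∈ Icc t π, 0 ≤ cos (s / 2) := fun s hs =>
    cos_nonneg_of_neg_pi_div_two_le_of_le (by linarith [hs.1, pi_pos]) (by linarith [hs.2])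
  have hg : ∀ s ∈ Icc t π, HasDerivAt (fun s => (l * sin (s / 2))⁻¹)
      (-(cos (s / 2) / (2 * l * sin (s / 2) ^ 2))) s := fun s hs => by
    have h0 := (hsin s hs).ne'
    have h := (((hasDerivAt_id s).div_const 2).sin.const_mul l).inv (mul_ne_zero hl0.ne' h0)
    refine h.congr_deriv ?_
    simp only [id]
    field_simp
  have hEd : ∀ s ∈ Icc t π, HasDerivAt E
      (-(cos (l * s) * (cos (s / 2) / (2 * l * sin (s / 2) ^ 2)))) s := fun s hs => by
    have h0 := (hsin s hs).ne'
    have h1 := ((hasDerivAt_id s).const_mul l).cos.mul (hg s hs)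
    have h := ((hasDerivAt_dirichletPrimitive N s).sub_const π).add h1
    refine h.congr_deriv ?_
    have hk := dirichletKernel_mul_sin N s
    rw [← hl, ← eq_div_iff h0] at hk
    simp only [id, hk]
    field_simp
    ring
  have hder : ∀ s ∈ Icc t π, 0 ≤ cos (s / 2) / (2 * l * sin (s / 2) ^ 2) := fun s hs =>
    div_nonneg (hcos s hs) (by positivity)
  have hmono : MonotoneOn (fun s => E s - (l * sin (s / 2))⁻¹) (Icc t π) := by
    refine monotoneOn_of_hasDerivWithinAt_nonneg (convex_Icc t π)
      (fun s hs => ((hEd s hs).sub (hg s hs)).continuousAt.continuousWithinAt)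
      (fun s hs => ((hEd s (interior_subset hs)).sub
        (hg s (interior_subset hs))).hasDerivWithinAt) fun s hs => ?_
    nlinarith [hder s (interior_subset hs), cos_le_one (l * s)]
  have hanti : AntitoneOn (fun s => E s + (l * sin (s / 2))⁻¹) (Icc t π) := by
    refine antitoneOn_of_hasDerivWithinAt_nonpos (convex_Icc t π)
      (fun s hs => ((hEd s hs).add (hg s hs)).continuousAt.continuousWithinAt)
      (fun s hs => ((hEd s (interior_subset hs)).add
        (hg s (interior_subset hs))).hasDerivWithinAt) fun s hs => ?_
    nlinarith [hder s (interior_subset hs), neg_one_le_cos (l * s)]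
  have htm : t ∈ Icc t π := ⟨le_rfl, htπ⟩
  have hπm : π ∈ Icc t π := ⟨htπ, le_rfl⟩
  -- `l π` is an odd multiple of `π / 2`, so the boundary term vanishes at `π`.
  have hcl : cos (l * π) = 0 := by
    rw [hl, add_mul, cos_add, sin_nat_mul_pi, show (1 / 2 * π : ℝ) = π / 2 by ring, cos_pi_div_two]
    simp
  have hEπ : E π = 0 := by simp [hE, hcl, dirichletPrimitive_pi]
  have h1 := hmono htm hπm htπ
  have h2 := hanti htm hπm htπ
  simp only [hEπ, sin_pi_div_two, mul_one] at h1 h2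
  have hli : 0 < l⁻¹ := inv_pos.2 hl0
  have hs0 := hsin t htm
  have hgt : 0 < (l * sin (t / 2))⁻¹ := by positivity
  have hc1 : |cos (l * t) / (l * sin (t / 2))| ≤ (l * sin (t / 2))⁻¹ := by
    rw [div_eq_mul_inv, abs_mul, abs_of_pos hgt]
    exact mul_le_of_le_one_left hgt.le (abs_cos_le_one _)
  have hEt : E t = dirichletPrimitive N t - π + cos (l * t) / (l * sin (t / 2)) := rfl
  have hfin : (4 : ℝ) / ((2 * N + 1) * sin (t / 2)) = 2 * (l * sin (t / 2))⁻¹ := by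
    rw [hl]; field_simp; ring
  rw [hfin, abs_le]
  obtain ⟨h3, h4⟩ := abs_le.1 hc1
  constructor <;> linarith

/-- Jordan's inequality `sin (t / 2) ≥ t / π` makes the decay explicit in `t`. -/
theorem mul_abs_dirichletPrimitive_sub_pi_le (N : ℕ) {t : ℝ} (ht : 0 < t) (htπ : t ≤ π) :
    (2 * N + 1) * t * |dirichletPrimitive N t - π| ≤ 4 * π := by
  have hs : t / π ≤ sin (t / 2) := by
    have := mul_le_sin (x := t / 2) (by linarith) (by linarith)
    calc t / π = 2 / π * (t / 2) := by ring
      _ ≤ _ := this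
  have hs0 : 0 < sin (t / 2) := lt_of_lt_of_le (by positivity) hs
  have h := abs_dirichletPrimitive_sub_pi_le N ht htπ
  have hL : (0 : ℝ) < 2 * N + 1 := by positivity
  calc (2 * N + 1) * t * |dirichletPrimitive N t - π|
      ≤ (2 * N + 1) * t * (4 / ((2 * N + 1) * sin (t / 2))) := by gcongr
    _ = 4 * (t / sin (t / 2)) := by field_simp
    _ ≤ 4 * π := by
      gcongr
      rw [div_le_iff₀ hs0]
      rw [div_le_iff₀ pi_pos] at hs
      linarith

/-- Below the scale `1 / (2 N + 1)` the linear bound on the primitive suffices; above it the decay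
estimate does. The reflection `t ↦ 2 π - t` carries the bound past `π`. -/
theorem abs_dirichletPrimitive_sub_pi_le_four_pi (N : ℕ) {t : ℝ} (ht : 0 ≤ t) (ht2 : t ≤ 2 * π) :
    |dirichletPrimitive N t - π| ≤ 4 * π := by
  have key : ∀ s : ℝ, 0 ≤ s → s ≤ π → |dirichletPrimitive N s - π| ≤ 4 * π := by
    intro s hs hsπ
    rcases le_total ((2 * N + 1) * s) 1 with h | h
    · have h1 := (abs_dirichletPrimitive_le_mul N hs).trans h
      have := abs_sub (dirichletPrimitive N s) π
      rw [abs_of_pos pi_pos] at this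
      linarith [pi_gt_three]
    · have hs0 : 0 < s := by
        rcases hs.eq_or_lt with rfl | h'
        · norm_num at h
        · exact h'
      refine le_trans ?_ (mul_abs_dirichletPrimitive_sub_pi_le N hs0 hsπ)
      exact le_mul_of_one_le_left (abs_nonneg _) h
  rcases le_total t π with h | h
  · exact key t ht h
  · have := key (2 * π - t) (by linarith) (by linarith)
    rw [dirichletPrimitive_two_pi_sub, show 2 * π - dirichletPrimitive N t - π
      = -(dirichletPrimitive N t - π) by ring, abs_neg] at this
    exact this

theorem abs_dirichletPrimitive_le (N : ℕ) {t : ℝ} (ht : |t| ≤ 2 * π) :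
    |dirichletPrimitive N t| ≤ 5 * π := by
  have key : ∀ s : ℝ, 0 ≤ s → s ≤ 2 * π → |dirichletPrimitive N s| ≤ 5 * π := by
    intro s hs hs2
    have h := abs_dirichletPrimitive_sub_pi_le_four_pi N hs hs2
    rw [abs_le] at h ⊢
    constructor <;> linarith [h.1, h.2, pi_pos]
  rcases abs_cases t with ⟨h, h0⟩ | ⟨h, h0⟩
  · exact key t h0 (h ▸ ht)
  · have := key (-t) (by linarith) (h ▸ ht)
    rwa [dirichletPrimitive_neg, abs_neg] at this

/-- The primitive of the Dirichlet kernel approaches the step function `π sgn` in mean square, at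
the rate given by the right-hand side. -/
theorem sq_dirichletPrimitive_sub_pi_le (N : ℕ) {t : ℝ} (ht : 0 ≤ t) (ht2 : t ≤ 7 * π / 4) :
    (dirichletPrimitive N t - π) ^ 2 ≤ 800 * π ^ 2 / (1 + ((2 * N + 1) * t) ^ 2) := by
  have h1 := abs_dirichletPrimitive_sub_pi_le_four_pi N ht (by linarith [pi_pos])
  have h2 : (2 * N + 1) * t * |dirichletPrimitive N t - π| ≤ 28 * π := by
    rcases ht.eq_or_lt with rfl | ht0
    · simp; positivity
    rcases le_total t π with h | h
    · linarith [mul_abs_dirichletPrimitive_sub_pi_le N ht0 h, pi_pos]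
    · have := mul_abs_dirichletPrimitive_sub_pi_le N (t := 2 * π - t) (by linarith [pi_pos])
        (by linarith)
      rw [dirichletPrimitive_two_pi_sub, show 2 * π - dirichletPrimitive N t - π
        = -(dirichletPrimitive N t - π) by ring, abs_neg] at this
      -- This uses `t ≤ 7 π / 4`, which keeps `t` away from the next jump at `2 π`; it turns `4 π`
      -- into `28 π`.
      have h7 : t ≤ 7 * (2 * π - t) := by linarith
      calc (2 * N + 1) * t * |dirichletPrimitive N t - π|
          ≤ (2 * N + 1) * (7 * (2 * π - t)) * |dirichletPrimitive N t - π| := by gcongr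
        _ = 7 * ((2 * N + 1) * (2 * π - t) * |dirichletPrimitive N t - π|) := by ring
        _ ≤ 7 * (4 * π) := by gcongr
        _ = 28 * π := by ring
  -- The constant is `800 = 4 ^ 2 + 28 ^ 2`.
  rw [le_div_iff₀ (by positivity), mul_add, mul_one, ← sq_abs (dirichletPrimitive N t - π),
    ← mul_pow]
  have h3 := pow_le_pow_left₀ (abs_nonneg _) h1 2
  have h4 := pow_le_pow_left₀ (by positivity) h2 2
  rw [mul_comm (|_|)]
  nlinarith

theorem integral_exp_int_mul (k : ℤ) (c : ℝ) :
    ∫ t in c..(c + 2 * π), Complex.exp (Complex.I * k * t) = if k = 0 then (2 * π : ℂ) else 0 := by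
  split_ifs with hk
  · simp [hk]
  · have h0 : Complex.I * k ≠ 0 := mul_ne_zero Complex.I_ne_zero (by exact_mod_cast hk)
    rw [integral_exp_mul_complex h0]
    have : Complex.I * k * ((c + 2 * π : ℝ) : ℂ) = Complex.I * k * c + k * (2 * π * Complex.I) := by
      push_cast; ring
    rw [this, Complex.exp_add, Complex.exp_int_mul_two_pi_mul_I]
    simp

theorem dirichletKernel_eq_sum_exp (N : ℕ) (t : ℝ) :
    (dirichletKernel N t : ℂ) = ∑ k ∈ Finset.Icc (-(N : ℤ)) N, Complex.exp (Complex.I * k * t) := by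
  induction N with
  | zero => simp [dirichletKernel]
  | succ N ih =>
    have h : dirichletKernel (N + 1) t = dirichletKernel N t + 2 * cos ((N + 1 : ℝ) * t) := by
      simp only [dirichletKernel, Finset.sum_range_succ]; ring
    have hI : Finset.Icc (-((N + 1 : ℕ) : ℤ)) ((N + 1 : ℕ) : ℤ)
        = insert (-((N + 1 : ℕ) : ℤ)) (insert ((N + 1 : ℕ) : ℤ) (Finset.Icc (-(N : ℤ)) N)) := by
      ext k; simp only [Finset.mem_Icc, Finset.mem_insert]; push_cast; omega
    rw [hI, Finset.sum_insert, Finset.sum_insert, ← ih, h]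
    · push_cast
      rw [Complex.cos]
      ring_nf
    · simp
    · simp only [Finset.mem_Icc, Finset.mem_insert]; push_cast; omega

/-- Parseval: in the double sum of exponentials only the `2 N + 1` pairs with opposite frequencies
survive over a period. -/
theorem integral_dirichletKernel_sq (N : ℕ) (c : ℝ) :
    ∫ t in c..(c + 2 * π), dirichletKernel N t ^ 2 = 2 * π * (2 * N + 1) := by
  have h : (∫ t in c..(c + 2 * π), ((dirichletKernel N t ^ 2 : ℝ) : ℂ))
      = ((2 * π * (2 * N + 1) : ℝ) : ℂ) := by
    have e : ∀ t : ℝ, ((dirichletKernel N t ^ 2 : ℝ) : ℂ) = ∑ k ∈ Finset.Icc (-(N : ℤ)) N,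
        ∑ l ∈ Finset.Icc (-(N : ℤ)) N, Complex.exp (Complex.I * ((k + l : ℤ) : ℂ) * t) := by
      intro t
      push_cast
      rw [sq, dirichletKernel_eq_sum_exp, Finset.sum_mul_sum]
      refine Finset.sum_congr rfl fun k _ => Finset.sum_congr rfl fun l _ => ?_
      rw [← Complex.exp_add]; ring_nf
    simp_rw [e]
    have hInt : ∀ k : ℤ, IntervalIntegrable
        (fun t : ℝ => Complex.exp (Complex.I * (k : ℂ) * t)) volume c (c + 2 * π) := fun k =>
      Continuous.intervalIntegrable (by fun_prop) _ _
    rw [intervalIntegral.integral_finsetSum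
      fun k _ => Continuous.intervalIntegrable (by fun_prop) _ _]
    have e2 : ∀ k ∈ Finset.Icc (-(N : ℤ)) N, ∫ t in c..(c + 2 * π),
        ∑ l ∈ Finset.Icc (-(N : ℤ)) N, Complex.exp (Complex.I * ((k + l : ℤ) : ℂ) * t)
        = 2 * π := by
      intro k hk
      rw [intervalIntegral.integral_finsetSum fun l _ => hInt (k + l)]
      simp_rw [integral_exp_int_mul]
      rw [Finset.sum_eq_single (-k)]
      · simp
      · intro l _ hl; exact if_neg (by omega)
      · intro hk'; simp only [Finset.mem_Icc] at hk hk'; omega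
    rw [Finset.sum_congr rfl e2]
    simp only [Finset.sum_const, Int.card_Icc, nsmul_eq_mul]
    have : ((N : ℤ) + 1 - -(N : ℤ)).toNat = 2 * N + 1 := by omega
    rw [this]; push_cast; ring
  rw [intervalIntegral.integral_ofReal] at h
  exact_mod_cast h

/-! ### Pairings with Dirichlet kernels along a circular arc. -/

/-- Integration by parts against the Dirichlet kernel: the bound does not depend on `N`. -/
theorem abs_integral_mul_dirichletKernel_comp_le (N : ℕ) {α β y A B : ℝ} (hαβ : α ≤ β)
    {q q' h h' : ℝ → ℝ} (hq : ∀ v ∈ Icc α β, HasDerivAt q (q' v) v)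
    (hh : ∀ v ∈ Icc α β, HasDerivAt h (h' v) v)
    (hq' : ContinuousOn q' (Icc α β)) (hh' : ContinuousOn h' (Icc α β))
    (hA : ∀ v ∈ Icc α β, |q v| ≤ A) (hB : ∀ v ∈ Icc α β, |q' v| ≤ B)
    (hy : ∀ v ∈ Icc α β, |y - h v| ≤ 2 * π) :
    |∫ v in α..β, q v * (dirichletKernel N (y - h v) * h' v)|
      ≤ 5 * π * (2 * A + B * (β - α)) := by
  have hu : uIcc α β = Icc α β := uIcc_of_le hαβ
  have hF : ∀ v ∈ Icc α β, HasDerivAt (fun v => -dirichletPrimitive N (y - h v))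
      (dirichletKernel N (y - h v) * h' v) v := fun v hv => by
    have := ((hasDerivAt_dirichletPrimitive N (y - h v)).comp v
      ((hasDerivAt_const v y).sub (hh v hv))).neg
    refine this.congr_deriv ?_
    ring
  have hhc : ContinuousOn h (Icc α β) := fun v hv => (hh v hv).continuousAt.continuousWithinAt
  have hcont : ContinuousOn (fun v => dirichletKernel N (y - h v) * h' v) (Icc α β) :=
    ((continuous_dirichletKernel N).comp_continuousOn (continuousOn_const.sub hhc)).mul hh'
  rw [integral_mul_deriv_eq_deriv_mul (hu ▸ hq) (hu ▸ hF)
    (hq'.intervalIntegrable_of_Icc hαβ) (hcont.intervalIntegrable_of_Icc hαβ)]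
  have hα : α ∈ Icc α β := ⟨le_rfl, hαβ⟩
  have hβ : β ∈ Icc α β := ⟨hαβ, le_rfl⟩
  have hA0 : 0 ≤ A := (abs_nonneg _).trans (hA α hα)
  have hB0 : 0 ≤ B := (abs_nonneg _).trans (hB α hα)
  have hb : ∀ v ∈ Icc α β, |q v * -dirichletPrimitive N (y - h v)| ≤ A * (5 * π) := fun v hv => by
    rw [abs_mul, abs_neg]
    exact mul_le_mul (hA v hv) (abs_dirichletPrimitive_le N (hy v hv)) (abs_nonneg _) hA0
  have hi : |∫ v in α..β, q' v * -dirichletPrimitive N (y - h v)| ≤ B * (5 * π) * |β - α| := by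
    rw [← norm_eq_abs]
    refine intervalIntegral.norm_integral_le_of_norm_le_const fun v hv => ?_
    have hv' : v ∈ Icc α β := by
      rw [uIoc_of_le hαβ] at hv; exact Ioc_subset_Icc_self hv
    rw [norm_mul, norm_neg]
    exact mul_le_mul (hB v hv') (abs_dirichletPrimitive_le N (hy v hv')) (abs_nonneg _) hB0
  rw [abs_of_nonneg (by linarith : 0 ≤ β - α)] at hi
  have h1 := hb α hα
  have h2 := hb β hβ
  rw [abs_le] at *
  constructor <;> nlinarith [h1.1, h1.2, h2.1, h2.2, hi.1, hi.2]

/-- The upper boundary of the disk of radius `π`. -/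
noncomputable def arc (u : ℝ) : ℝ := √(π ^ 2 - u ^ 2)

/-- The derivative of `arc`. -/
noncomputable def arcDeriv (u : ℝ) : ℝ := -(u / arc u)

theorem pi_div_sqrt_two_sq : (π / √2) ^ 2 = π ^ 2 / 2 := by
  rw [div_pow, sq_sqrt (by norm_num)]

theorem pi_div_sqrt_two_pos : 0 < π / √2 := by positivity

theorem pi_div_sqrt_two_le : π / √2 ≤ 3 * π / 4 := by
  refine abs_le_of_sq_le_sq' ?_ (by positivity) |>.2
  rw [pi_div_sqrt_two_sq]; nlinarith [sq_nonneg π]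

section arc

variable {u : ℝ}

/-- Up to the abscissa `π / √2` of the diagonal point the arc lies at least as high as that
abscissa, which keeps its slope between `-1` and `0`. -/
theorem arc_mem (hu : u ∈ Icc 0 (π / √2)) : arc u ∈ Icc (π / √2) π := by
  have h := pow_le_pow_left₀ hu.1 hu.2 2
  rw [pi_div_sqrt_two_sq] at h
  refine ⟨le_sqrt_of_sq_le (by rw [pi_div_sqrt_two_sq]; linarith), ?_⟩
  exact sqrt_le_iff.2 ⟨pi_pos.le, by nlinarith⟩

theorem hasDerivAt_arc (hu : u ∈ Icc 0 (π / √2)) : HasDerivAt arc (arcDeriv u) u := by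
  have h0 : 0 < arc u := pi_div_sqrt_two_pos.trans_le (arc_mem hu).1
  have h1 : π ^ 2 - u ^ 2 ≠ 0 := (sqrt_pos.1 h0).ne'
  refine (((hasDerivAt_const u (π ^ 2)).sub (hasDerivAt_pow 2 u)).sqrt h1).congr_deriv ?_
  have : √(π ^ 2 - u ^ 2) = arc u := rfl
  simp only [arcDeriv, Pi.sub_apply, this]
  field_simp
  simp

theorem continuousOn_arc : ContinuousOn arc (Icc 0 (π / √2)) := fun _ hu =>
  (hasDerivAt_arc hu).continuousAt.continuousWithinAt

theorem continuousOn_arcDeriv : ContinuousOn arcDeriv (Icc 0 (π / √2)) :=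
  (continuousOn_id.div continuousOn_arc fun _ hu =>
    (pi_div_sqrt_two_pos.trans_le (arc_mem hu).1).ne').neg

theorem neg_arcDeriv_mem (hu : u ∈ Icc 0 (π / √2)) : -arcDeriv u ∈ Icc 0 1 := by
  have h0 : 0 < arc u := pi_div_sqrt_two_pos.trans_le (arc_mem hu).1
  simp only [arcDeriv, neg_neg]
  exact ⟨div_nonneg hu.1 h0.le, (div_le_one h0).2 (hu.2.trans (arc_mem hu).1)⟩

end arc

/-- With `t = y - arc u` the slope is the Jacobian, and the range of `t` is shorter than a period,
so the integral is at most the one over a full period. -/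
theorem integral_dirichletKernel_sq_arc_le (N : ℕ) {α β : ℝ} (y : ℝ) (hαβ : α ≤ β)
    (hsub : Icc α β ⊆ Icc 0 (π / √2)) :
    ∫ u in α..β, dirichletKernel N (y - arc u) ^ 2 * -arcDeriv u ≤ 2 * π * (2 * N + 1) := by
  have hα : α ∈ Icc α β := ⟨le_rfl, hαβ⟩
  have hβ : β ∈ Icc α β := ⟨hαβ, le_rfl⟩
  have hu : uIcc α β = Icc α β := uIcc_of_le hαβ
  have hcd : Continuous fun t => dirichletKernel N t ^ 2 := (continuous_dirichletKernel N).pow 2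
  have hder : ∀ u ∈ uIcc α β, HasDerivAt (fun u => y - arc u) (-arcDeriv u) u := fun u hu' => by
    exact (hasDerivAt_arc (hsub (hu ▸ hu'))).const_sub y
  have hsubst := integral_comp_mul_deriv (f := fun u => y - arc u)
    (g := fun t => dirichletKernel N t ^ 2) hder
    (by rw [hu]; exact (continuousOn_arcDeriv.mono hsub).neg) hcd
  simp only [Function.comp_def] at hsubst
  rw [hsubst, ← integral_dirichletKernel_sq N (y - arc α)]
  have hαm := arc_mem (hsub hα)
  have hβm := arc_mem (hsub hβ)
  have hmono : arc β ≤ arc α := sqrt_le_sqrt (by nlinarith [(hsub hα).1])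
  refine integral_mono_interval le_rfl (by linarith) 
    (by linarith [hαm.2, hβm.1, pi_div_sqrt_two_pos, pi_pos])
    (Filter.Eventually.of_forall fun t => sq_nonneg _) (hcd.intervalIntegrable _ _)

/-- The integrand has an arctangent as primitive, so its mass is at most `π` whatever `L` is. -/
theorem integral_div_one_add_sq_le {L : ℝ} (α β x : ℝ) :
    ∫ u in α..β, L / (1 + (L * (x - u)) ^ 2) ≤ π := by
  have hd : ∀ u ∈ uIcc α β, HasDerivAt (fun u => -arctan (L * (x - u)))
      (L / (1 + (L * (x - u)) ^ 2)) u := fun u _ => by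
    have := ((((hasDerivAt_const u x).sub (hasDerivAt_id u)).const_mul L).arctan).neg
    refine this.congr_deriv ?_
    simp [div_eq_inv_mul]
  rw [integral_eq_sub_of_hasDerivAt hd (Continuous.intervalIntegrable
    (continuous_const.div (by fun_prop) fun u => by positivity) _ _)]
  linarith [arctan_lt_pi_div_two (L * (x - α)), neg_pi_div_two_lt_arctan (L * (x - β))]

/-- On a stretch where the primitive of the Dirichlet kernel is close to the constant `σ` in mean
square, the difference pairs boundedly with the Dirichlet kernel along the arc. -/
theorem abs_integral_error_arc_le (N : ℕ) {α β σ x y A K : ℝ} (hαβ : α ≤ β)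
    (hsub : Icc α β ⊆ Icc 0 (π / √2)) {q : ℝ → ℝ}
    (hA : ∀ u ∈ Icc α β, |q u| ≤ A) (hK : 0 ≤ K)
    (hσ : ∀ u ∈ Icc α β,
      (dirichletPrimitive N (x - u) - σ) ^ 2 ≤ K / (1 + ((2 * N + 1) * (x - u)) ^ 2)) :
    |∫ u in α..β, (dirichletPrimitive N (x - u) - σ) *
      (q u * (dirichletKernel N (y - arc u) * arcDeriv u))| ≤ A * (K * π + 2 * π) := by
  set L : ℝ := 2 * N + 1 with hL
  have hL0 : 0 < L := by positivity
  have hα : α ∈ Icc α β := ⟨le_rfl, hαβ⟩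
  have hA0 : 0 ≤ A := (abs_nonneg _).trans (hA α hα)
  have hc1 : Continuous fun u => L / (1 + (L * (x - u)) ^ 2) :=
    continuous_const.div (by fun_prop) fun u => by positivity
  have hc2 : ContinuousOn (fun u => dirichletKernel N (y - arc u) ^ 2 * -arcDeriv u) (Icc α β) :=
    (((continuous_dirichletKernel N).comp_continuousOn
      (continuousOn_const.sub (continuousOn_arc.mono hsub))).pow 2).mul
      (continuousOn_arcDeriv.mono hsub).neg
  have hi1 : IntervalIntegrable (fun u => A * K * (L / (1 + (L * (x - u)) ^ 2))) volume α β :=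
    (continuous_const.mul hc1).intervalIntegrable _ _
  have hi2 : IntervalIntegrable
      (fun u => A * L⁻¹ * (dirichletKernel N (y - arc u) ^ 2 * -arcDeriv u)) volume α β :=
    (hc2.intervalIntegrable_of_Icc hαβ).const_mul _
  have hle : ∀ᵐ u, u ∈ Ioc α β → ‖(dirichletPrimitive N (x - u) - σ) *
      (q u * (dirichletKernel N (y - arc u) * arcDeriv u))‖ ≤
      A * K * (L / (1 + (L * (x - u)) ^ 2)) +
        A * L⁻¹ * (dirichletKernel N (y - arc u) ^ 2 * -arcDeriv u) := by
    refine Filter.Eventually.of_forall fun u hu => ?_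
    have hu' := Ioc_subset_Icc_self hu
    obtain ⟨h0, h1⟩ := neg_arcDeriv_mem (hsub hu')
    have hs := hσ u hu'
    have hq := hA u hu'
    set e := dirichletPrimitive N (x - u) - σ
    set D := dirichletKernel N (y - arc u)
    set s := -arcDeriv u with hsdef
    have hsa : |arcDeriv u| = s := by rw [← abs_neg, abs_of_nonneg h0]
    rw [norm_eq_abs, abs_mul, abs_mul, abs_mul, hsa]
    -- The weights `L` and `L⁻¹` balance the two mean squares: that of `e` is of order `1 / L` and
    -- that of `D` of order `L`.
    have hprod : |e| * |D| ≤ L * e ^ 2 + L⁻¹ * D ^ 2 := by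
      rw [← sq_abs e, ← sq_abs D]
      have : L * |e| ^ 2 + L⁻¹ * |D| ^ 2 = (L * |e| - |D|) ^ 2 * L⁻¹ + 2 * (|e| * |D|) := by
        field_simp; ring
      rw [this]
      have : 0 ≤ (L * |e| - |D|) ^ 2 * L⁻¹ := by positivity
      nlinarith [mul_nonneg (abs_nonneg e) (abs_nonneg D)]
    calc |e| * (|q u| * (|D| * s)) ≤ |e| * (A * (|D| * s)) := by gcongr
      _ = A * ((|e| * |D|) * s) := by ring
      _ ≤ A * ((L * e ^ 2 + L⁻¹ * D ^ 2) * s) := by gcongr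
      _ = A * (L * e ^ 2 * s) + A * L⁻¹ * (D ^ 2 * s) := by ring
      -- The slope is bounded by `1` in the first term only; the second keeps it as the Jacobian of
      -- the substitution along the arc.
      _ ≤ A * (L * (K / (1 + (L * (x - u)) ^ 2)) * 1) + A * L⁻¹ * (D ^ 2 * s) := by gcongr
      _ = _ := by ring
  refine (intervalIntegral.norm_integral_le_of_norm_le hαβ hle (hi1.add hi2)).trans ?_
  rw [intervalIntegral.integral_add hi1 hi2, intervalIntegral.integral_const_mul,
    intervalIntegral.integral_const_mul]
  have h1 := integral_div_one_add_sq_le (L := L) α β x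
  have h2 := integral_dirichletKernel_sq_arc_le N y hαβ hsub
  rw [← hL] at h2
  calc A * K * (∫ u in α..β, L / (1 + (L * (x - u)) ^ 2)) +
      A * L⁻¹ * ∫ u in α..β, dirichletKernel N (y - arc u) ^ 2 * -arcDeriv u
      ≤ A * K * π + A * L⁻¹ * (2 * π * L) := by gcongr
    _ = A * (K * π + 2 * π) := by field_simp

theorem sq_dirichletPrimitive_add_pi_le (N : ℕ) {t : ℝ} (ht : t ≤ 0) (ht2 : -(7 * π / 4) ≤ t) :
    (dirichletPrimitive N t - -π) ^ 2 ≤ 800 * π ^ 2 / (1 + ((2 * N + 1) * t) ^ 2) := by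
  have h := sq_dirichletPrimitive_sub_pi_le N (t := -t) (by linarith) (by linarith)
  rw [dirichletPrimitive_neg] at h
  rw [mul_neg, neg_sq] at h
  rwa [show dirichletPrimitive N t - -π = -(-dirichletPrimitive N t - π) by ring, neg_sq]

/-- The primitive is replaced by `π` for `u < x` and by `-π` for `u > x`, so the range is cut at `u
= x` when that lies inside. On each piece the constant is treated by integration by parts along the
arc and the remainder in mean square. Since `u ≤ 3 π / 4`, the argument `x - u` stays in `[-7 π / 4,
π]`, where the step estimate is valid. -/
theorem abs_integral_primitive_arc_le (N : ℕ) {x y A B : ℝ} (hx : |x| ≤ π) (hy : |y| ≤ π)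
    {q q' : ℝ → ℝ} (hq : ∀ u ∈ Icc 0 (π / √2), HasDerivAt q (q' u) u)
    (hq' : ContinuousOn q' (Icc 0 (π / √2)))
    (hA : ∀ u ∈ Icc 0 (π / √2), |q u| ≤ A) (hB : ∀ u ∈ Icc 0 (π / √2), |q' u| ≤ B) :
    |∫ u in 0..(π / √2), dirichletPrimitive N (x - u) *
      (q u * (dirichletKernel N (y - arc u) * arcDeriv u))|
      ≤ 2 * (π * (5 * π * (2 * A + B * π)) + A * (800 * π ^ 2 * π + 2 * π)) := by
  have hb0 := pi_div_sqrt_two_pos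
  have hb1 := pi_div_sqrt_two_le
  have hπ := pi_pos
  obtain ⟨hx1, hx2⟩ := abs_le.1 hx
  obtain ⟨hy1, hy2⟩ := abs_le.1 hy
  have hA0 : 0 ≤ A := (abs_nonneg _).trans (hA 0 ⟨le_rfl, hb0.le⟩)
  have hB0 : 0 ≤ B := (abs_nonneg _).trans (hB 0 ⟨le_rfl, hb0.le⟩)
  have hqc : ContinuousOn q (Icc 0 (π / √2)) := fun u hu =>
    (hq u hu).continuousAt.continuousWithinAt
  have hKc : ContinuousOn (fun u => q u * (dirichletKernel N (y - arc u) * arcDeriv u))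
      (Icc 0 (π / √2)) :=
    hqc.mul (((continuous_dirichletKernel N).comp_continuousOn
      (continuousOn_const.sub continuousOn_arc)).mul continuousOn_arcDeriv)
  have hFc : Continuous fun u => dirichletPrimitive N (x - u) :=
    (continuous_dirichletPrimitive N).comp (by fun_prop)
  have hFKc : ContinuousOn (fun u => dirichletPrimitive N (x - u) *
      (q u * (dirichletKernel N (y - arc u) * arcDeriv u))) (Icc 0 (π / √2)) :=
    hFc.continuousOn.mul hKc
  have piece : ∀ α β σ : ℝ, α ≤ β → Icc α β ⊆ Icc 0 (π / √2) → |σ| = π →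
      (∀ u ∈ Icc α β, (dirichletPrimitive N (x - u) - σ) ^ 2
        ≤ 800 * π ^ 2 / (1 + ((2 * N + 1) * (x - u)) ^ 2)) →
      |∫ u in α..β, dirichletPrimitive N (x - u) *
        (q u * (dirichletKernel N (y - arc u) * arcDeriv u))|
      ≤ π * (5 * π * (2 * A + B * π)) + A * (800 * π ^ 2 * π + 2 * π) := by
    intro α β σ hαβ hsub hσ hs
    have h1 := abs_integral_mul_dirichletKernel_comp_le N hαβ (y := y)
      (fun v hv => hq v (hsub hv)) (fun v hv => hasDerivAt_arc (hsub hv)) (hq'.mono hsub)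
      (continuousOn_arcDeriv.mono hsub) (fun v hv => hA v (hsub hv)) (fun v hv => hB v (hsub hv))
      (fun v hv => by
        have := arc_mem (hsub hv)
        rw [abs_le]; constructor <;> linarith [this.1, this.2])
    have h2 := abs_integral_error_arc_le N (y := y) hαβ hsub (fun u hu => hA u (hsub hu))
      (by positivity) hs
    have hlen : β - α ≤ π := by
      linarith [(hsub ⟨hαβ, le_rfl⟩).2, (hsub ⟨le_rfl, hαβ⟩).1]
    have hi1 : IntervalIntegrable
        (fun u => σ * (q u * (dirichletKernel N (y - arc u) * arcDeriv u))) volume α β :=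
      ((hKc.mono hsub).intervalIntegrable_of_Icc hαβ).const_mul σ
    have hi2 : IntervalIntegrable (fun u => (dirichletPrimitive N (x - u) - σ) *
        (q u * (dirichletKernel N (y - arc u) * arcDeriv u))) volume α β :=
      (((hFc.sub continuous_const).continuousOn.mul hKc).mono hsub).intervalIntegrable_of_Icc hαβ
    have hsplit : (fun u => dirichletPrimitive N (x - u) *
        (q u * (dirichletKernel N (y - arc u) * arcDeriv u))) = fun u =>
        σ * (q u * (dirichletKernel N (y - arc u) * arcDeriv u)) +
        (dirichletPrimitive N (x - u) - σ) *
          (q u * (dirichletKernel N (y - arc u) * arcDeriv u)) := by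
      funext u; ring
    rw [hsplit, intervalIntegral.integral_add hi1 hi2, intervalIntegral.integral_const_mul]
    refine (abs_add_le _ _).trans (add_le_add ?_ h2)
    rw [abs_mul, hσ]
    refine mul_le_mul_of_nonneg_left (h1.trans ?_) hπ.le
    gcongr
  have hC : 0 ≤ π * (5 * π * (2 * A + B * π)) + A * (800 * π ^ 2 * π + 2 * π) := by positivity
  have hright : ∀ u ∈ Icc (max x 0) (π / √2), (dirichletPrimitive N (x - u) - -π) ^ 2
      ≤ 800 * π ^ 2 / (1 + ((2 * N + 1) * (x - u)) ^ 2) := fun u hu =>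
    sq_dirichletPrimitive_add_pi_le N (by linarith [(le_max_left x 0).trans hu.1])
      (by linarith [hu.2])
  have hleft : ∀ u ∈ Icc 0 (min x (π / √2)), (dirichletPrimitive N (x - u) - π) ^ 2
      ≤ 800 * π ^ 2 / (1 + ((2 * N + 1) * (x - u)) ^ 2) := fun u hu =>
    sq_dirichletPrimitive_sub_pi_le N (by linarith [hu.2.trans (min_le_left x _)])
      (by linarith [hu.1])
  have hsπ : |(-π)| = π := by rw [abs_neg, abs_of_pos hπ]
  -- At most one sign change of `x - u` occurs, hence the factor `2` in the bound.
  rcases le_total x 0 with h | h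
  · rw [max_eq_right h] at hright
    linarith [piece 0 (π / √2) (-π) hb0.le subset_rfl hsπ hright]
  rcases le_total (π / √2) x with h' | h'
  · rw [min_eq_right h'] at hleft
    linarith [piece 0 (π / √2) π hb0.le subset_rfl (abs_of_pos hπ) hleft]
  rw [max_eq_left h] at hright
  rw [min_eq_left h'] at hleft
  have s1 : Icc 0 x ⊆ Icc 0 (π / √2) := Icc_subset_Icc le_rfl h'
  have s2 : Icc x (π / √2) ⊆ Icc 0 (π / √2) := Icc_subset_Icc h le_rfl
  rw [← integral_add_adjacent_intervals ((hFKc.mono s1).intervalIntegrable_of_Icc h)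
    ((hFKc.mono s2).intervalIntegrable_of_Icc h')]
  refine (abs_add_le _ _).trans ?_
  linarith [piece 0 x π h s1 (abs_of_pos hπ) hleft, piece x (π / √2) (-π) h' s2 hsπ hright]

/-- The circular cap over `[0, π / √2]`: pairing with the product of two Dirichlet kernels is
bounded uniformly in `N`. -/
theorem exists_abs_integral_cap_le {p p' r r' : ℝ → ℝ} (hp : ∀ t, HasDerivAt p (p' t) t)
    (hp' : Continuous p') (hr : ∀ t, HasDerivAt r (r' t) t) (hr' : Continuous r') :
    ∃ C, ∀ (N : ℕ) (x y : ℝ), |x| ≤ π → |y| ≤ π →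
      |∫ u in 0..(π / √2), dirichletKernel N (x - u) *
        (p u * ∫ v in (π / √2)..(arc u), dirichletKernel N (y - v) * r v)| ≤ C := by
  have hb0 := pi_div_sqrt_two_pos
  have hb1 := pi_div_sqrt_two_le
  have hπ := pi_pos
  have hbound : ∀ f : ℝ → ℝ, Continuous f → ∃ C, ∀ t ∈ Icc 0 π, |f t| ≤ C := fun f hf =>
    isCompact_Icc.exists_bound_of_continuousOn hf.continuousOn
  have hpc : Continuous p := continuous_iff_continuousAt.2 fun t => (hp t).continuousAt
  have hrc : Continuous r := continuous_iff_continuousAt.2 fun t => (hr t).continuousAt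
  obtain ⟨P, hP⟩ := hbound p hpc
  obtain ⟨P', hP'⟩ := hbound p' hp'
  obtain ⟨R, hR⟩ := hbound r hrc
  obtain ⟨R', hR'⟩ := hbound r' hr'
  have h0m : (0 : ℝ) ∈ Icc 0 π := ⟨le_rfl, hπ.le⟩
  have hP0 : 0 ≤ P := (abs_nonneg _).trans (hP 0 h0m)
  have hP'0 : 0 ≤ P' := (abs_nonneg _).trans (hP' 0 h0m)
  have hR0 : 0 ≤ R := (abs_nonneg _).trans (hR 0 h0m)
  have hR'0 : 0 ≤ R' := (abs_nonneg _).trans (hR' 0 h0m)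
  set S := 5 * π * (2 * R + R' * π) with hS
  have hS0 : 0 ≤ S := by positivity
  -- `A` and `B` bound `u ↦ p u * r (arc u)` and its derivative, the latter because the slope of the
  -- arc is at most `1` in absolute value.
  set A := P * R
  set B := P' * R + P * R'
  refine ⟨2 * (P * S * (5 * π)) + P' * S * (5 * π) * π +
    2 * (π * (5 * π * (2 * A + B * π)) + A * (800 * π ^ 2 * π + 2 * π)), fun N x y hx hy => ?_⟩
  obtain ⟨hx1, hx2⟩ := abs_le.1 hx
  obtain ⟨hy1, hy2⟩ := abs_le.1 hy
  have hsub : Icc 0 (π / √2) ⊆ Icc 0 π := Icc_subset_Icc le_rfl (by linarith)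
  have harc : ∀ u ∈ Icc 0 (π / √2), arc u ∈ Icc 0 π := fun u hu =>
    ⟨hb0.le.trans (arc_mem hu).1, (arc_mem hu).2⟩
  set Ψ : ℝ → ℝ := fun t => ∫ v in (π / √2)..t, dirichletKernel N (y - v) * r v with hΨ
  have hkr : Continuous fun v => dirichletKernel N (y - v) * r v :=
    ((continuous_dirichletKernel N).comp (by fun_prop)).mul hrc
  have hΨd : ∀ t, HasDerivAt Ψ (dirichletKernel N (y - t) * r t) t := fun t =>
    integral_hasDerivAt_right (hkr.intervalIntegrable _ _)
      (hkr.stronglyMeasurableAtFilter _ _) hkr.continuousAt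
  have hΨb : ∀ u ∈ Icc 0 (π / √2), |Ψ (arc u)| ≤ S := fun u hu => by
    have hm := arc_mem hu
    have := abs_integral_mul_dirichletKernel_comp_le N hm.1 (y := y) (h := id)
      (h' := fun _ => 1) (fun v _ => hr v) (fun v _ => hasDerivAt_id v) hr'.continuousOn
      continuousOn_const (fun v hv => hR v ⟨hb0.le.trans hv.1, hv.2.trans hm.2⟩)
      (fun v hv => hR' v ⟨hb0.le.trans hv.1, hv.2.trans hm.2⟩)
      (fun v hv => by
        simp only [id]
        rw [abs_le]; constructor <;> linarith [hv.1, hv.2, hm.2])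
    simp only [id, mul_one] at this
    simp only [hΨ]
    simp_rw [mul_comm (dirichletKernel N _)]
    refine this.trans ?_
    rw [hS]
    have : arc u - π / √2 ≤ π := by linarith [hm.2]
    gcongr
  have hΨc : ContinuousOn (fun u => Ψ (arc u)) (Icc 0 (π / √2)) :=
    (continuous_iff_continuousAt.2 fun t => (hΨd t).continuousAt).comp_continuousOn continuousOn_arc
  have hKc : ContinuousOn (fun u => dirichletKernel N (y - arc u)) (Icc 0 (π / √2)) :=
    (continuous_dirichletKernel N).comp_continuousOn (continuousOn_const.sub continuousOn_arc)
  have hrarc : ContinuousOn (fun u => r (arc u)) (Icc 0 (π / √2)) :=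
    hrc.comp_continuousOn continuousOn_arc
  have hFc : Continuous fun u => dirichletPrimitive N (x - u) :=
    (continuous_dirichletPrimitive N).comp (by fun_prop)
  -- Integrating by parts in `u` replaces the first kernel by its bounded primitive. Differentiating
  -- `p u * Ψ (arc u)` gives a bounded term and one carrying the second kernel on the arc; only the
  -- latter needs the arc estimate.
  have hφd : ∀ u ∈ Icc 0 (π / √2), HasDerivAt (fun u => p u * Ψ (arc u))
      (p' u * Ψ (arc u) +
        (p u * r (arc u)) * (dirichletKernel N (y - arc u) * arcDeriv u)) u := fun u hu => by
    refine ((hp u).mul ((hΨd (arc u)).comp u (hasDerivAt_arc hu))).congr_deriv ?_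
    simp only [Function.comp_def]
    ring
  have hc1 : ContinuousOn (fun u => p' u * Ψ (arc u)) (Icc 0 (π / √2)) :=
    hp'.continuousOn.mul hΨc
  have hc2 : ContinuousOn (fun u => (p u * r (arc u)) *
      (dirichletKernel N (y - arc u) * arcDeriv u)) (Icc 0 (π / √2)) :=
    (hpc.continuousOn.mul hrarc).mul (hKc.mul continuousOn_arcDeriv)
  have hFd : ∀ u, HasDerivAt (fun u => -dirichletPrimitive N (x - u))
      (dirichletKernel N (x - u)) u := fun u => by
    have := ((hasDerivAt_dirichletPrimitive N (x - u)).comp u ((hasDerivAt_id u).const_sub x)).neg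
    refine this.congr_deriv ?_
    ring
  have hu : uIcc 0 (π / √2) = Icc 0 (π / √2) := uIcc_of_le hb0.le
  have hibp := integral_mul_deriv_eq_deriv_mul (hu ▸ hφd) (fun u _ => hFd u)
    ((hc1.add hc2).intervalIntegrable_of_Icc hb0.le)
    (((continuous_dirichletKernel N).comp (by fun_prop)).intervalIntegrable _ _)
  have hI : ∫ u in 0..(π / √2), dirichletKernel N (x - u) * (p u * Ψ (arc u))
      = ∫ u in 0..(π / √2), p u * Ψ (arc u) * dirichletKernel N (x - u) := by
    simp_rw [mul_comm (dirichletKernel N _)]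
  have hi1 : IntervalIntegrable (fun u => dirichletPrimitive N (x - u) * (p' u * Ψ (arc u)))
      volume 0 (π / √2) := (hFc.continuousOn.mul hc1).intervalIntegrable_of_Icc hb0.le
  have hi2 : IntervalIntegrable (fun u => dirichletPrimitive N (x - u) * ((p u * r (arc u)) *
      (dirichletKernel N (y - arc u) * arcDeriv u))) volume 0 (π / √2) :=
    (hFc.continuousOn.mul hc2).intervalIntegrable_of_Icc hb0.le
  have hsplit : ∫ u in 0..(π / √2), (p' u * Ψ (arc u) + (p u * r (arc u)) *
      (dirichletKernel N (y - arc u) * arcDeriv u)) * -dirichletPrimitive N (x - u)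
      = -((∫ u in 0..(π / √2), dirichletPrimitive N (x - u) * (p' u * Ψ (arc u))) +
        ∫ u in 0..(π / √2), dirichletPrimitive N (x - u) * ((p u * r (arc u)) *
          (dirichletKernel N (y - arc u) * arcDeriv u))) := by
    rw [← intervalIntegral.integral_add hi1 hi2, ← intervalIntegral.integral_neg]
    congr 1; funext u; ring
  have hFb : ∀ u ∈ Icc 0 (π / √2), |dirichletPrimitive N (x - u)| ≤ 5 * π := fun u hu =>
    abs_dirichletPrimitive_le N (by rw [abs_le]; constructor <;> linarith [hu.1, hu.2])
  have hend : ∀ u ∈ Icc 0 (π / √2), |p u * Ψ (arc u) * -dirichletPrimitive N (x - u)|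
      ≤ P * S * (5 * π) := fun u hu => by
    rw [abs_mul, abs_mul, abs_neg]
    have h1 := hP u (hsub hu)
    have h2 := hΨb u hu
    have h3 := hFb u hu
    gcongr
  have hT1 : |∫ u in 0..(π / √2), dirichletPrimitive N (x - u) * (p' u * Ψ (arc u))|
      ≤ P' * S * (5 * π) * π := by
    have : |∫ u in 0..(π / √2), dirichletPrimitive N (x - u) * (p' u * Ψ (arc u))|
        ≤ P' * S * (5 * π) * |π / √2 - 0| := by
      rw [← norm_eq_abs]
      refine intervalIntegral.norm_integral_le_of_norm_le_const fun u hu' => ?_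
      have hum : u ∈ Icc 0 (π / √2) := by
        rw [uIoc_of_le hb0.le] at hu'; exact Ioc_subset_Icc_self hu'
      rw [norm_mul, norm_mul, norm_eq_abs, norm_eq_abs, norm_eq_abs, mul_comm]
      have h1 := hP' u (hsub hum)
      have h2 := hΨb u hum
      have h3 := hFb u hum
      gcongr
    rw [sub_zero, abs_of_pos hb0] at this
    refine this.trans ?_
    have : π / √2 ≤ π := by linarith
    gcongr
  have hT2 := abs_integral_primitive_arc_le N hx hy (q := fun u => p u * r (arc u))
    (q' := fun u => p' u * r (arc u) + p u * (r' (arc u) * arcDeriv u)) (A := A) (B := B)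
    (fun u hu => (hp u).mul ((hr (arc u)).comp u (hasDerivAt_arc hu)))
    ((hp'.continuousOn.mul hrarc).add (hpc.continuousOn.mul
      ((hr'.comp_continuousOn continuousOn_arc).mul continuousOn_arcDeriv)))
    (fun u hu => by
      rw [abs_mul]
      exact mul_le_mul (hP u (hsub hu)) (hR _ (harc u hu)) (abs_nonneg _) hP0)
    (fun u hu => by
      refine (abs_add_le _ _).trans (add_le_add ?_ ?_)
      · rw [abs_mul]
        exact mul_le_mul (hP' u (hsub hu)) (hR _ (harc u hu)) (abs_nonneg _) hP'0
      · have h1 := neg_arcDeriv_mem hu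
        rw [abs_mul, abs_mul]
        refine mul_le_mul (hP u (hsub hu)) ?_ (by positivity) hP0
        refine (mul_le_of_le_one_right (abs_nonneg _) ?_).trans (hR' _ (harc u hu))
        rw [abs_le]; constructor <;> linarith [h1.1, h1.2])
  have e1 := hend 0 ⟨le_rfl, hb0.le⟩
  have e2 := hend (π / √2) ⟨hb0.le, le_rfl⟩
  simp only [Pi.add_apply] at hibp
  rw [hI, hibp, hsplit]
  rw [abs_le] at *
  constructor <;> linarith [e1.1, e1.2, e2.1, e2.2, hT1.1, hT1.2, hT2.1, hT2.2]

/-! ### From the caps to the whole disk. -/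

theorem measurableSet_disk (r : ℝ) : MeasurableSet (disk r) :=
  measurableSet_le (by fun_prop) (by fun_prop)

theorem disk_subset_Icc {r : ℝ} (hr : 0 ≤ r) : disk r ⊆ Icc (-r) r ×ˢ Icc (-r) r := by
  intro z hz
  have hz' : z.1 ^ 2 + z.2 ^ 2 ≤ r ^ 2 := hz
  exact ⟨abs_le_of_sq_le_sq' (by nlinarith [sq_nonneg z.2]) hr,
    abs_le_of_sq_le_sq' (by nlinarith [sq_nonneg z.1]) hr⟩

theorem Continuous.integrableOn_disk {E : Type*} [NormedAddCommGroup E] {h : ℝ × ℝ → E}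
    (hh : Continuous h) {r : ℝ} (hr : 0 ≤ r) : IntegrableOn h (disk r) :=
  (hh.continuousOn.integrableOn_compact (isCompact_Icc.prod isCompact_Icc)).mono_set
    (disk_subset_Icc hr)

/-- An integral over a set invariant under an involution, folded onto a fundamental domain. -/
theorem setIntegral_eq_add_of_involutive {X : Type*} [MeasurableSpace X] {μ : Measure X}
    (ρ : X ≃ᵐ X) (hρ : MeasurePreserving ρ μ μ) (hinv : ∀ z, ρ (ρ z) = z) {S P : Set X}
    (hS : ρ ⁻¹' S = S) (hPm : MeasurableSet P) (hP : ρ ⁻¹' P =ᵐ[μ] (Pᶜ : Set X)) {h : X → ℝ}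
    (hh : IntegrableOn h S μ) :
    ∫ z in S, h z ∂μ = (∫ z in S ∩ P, h z ∂μ) + ∫ z in S ∩ P, h (ρ z) ∂μ := by
  rw [← integral_inter_add_sdiff hPm hh, sdiff_eq]
  congr 1
  have h1 : (S ∩ Pᶜ : Set X) =ᵐ[μ] ρ ⁻¹' (S ∩ P) := by
    rw [preimage_inter, hS]
    exact (Filter.EventuallyEq.refl _ _).inter hP.symm
  rw [setIntegral_congr_set h1,
    ← hρ.setIntegral_preimage_emb ρ.measurableEmbedding (fun z => h (ρ z)) (S ∩ P)]
  simp_rw [hinv]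

theorem setIntegral_disk_eq_add_fst {r : ℝ} {S : Set ℝ} {h : ℝ × ℝ → ℝ}
    (hh : IntegrableOn h (disk r ∩ univ ×ˢ S)) :
    ∫ z in disk r ∩ univ ×ˢ S, h z = (∫ z in disk r ∩ Ioi 0 ×ˢ S, h z) +
      ∫ z in disk r ∩ Ioi 0 ×ˢ S, h (-z.1, z.2) := by
  have hset : disk r ∩ Ioi 0 ×ˢ S = (disk r ∩ univ ×ˢ S) ∩ (Ioi 0 ×ˢ univ) := by
    ext z; simp only [mem_inter_iff, mem_prod, mem_univ, and_true, true_and]; tauto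
  rw [hset]
  refine setIntegral_eq_add_of_involutive
    ((MeasurableEquiv.neg ℝ).prodCongr (MeasurableEquiv.refl ℝ))
    ((Measure.measurePreserving_neg (volume : Measure ℝ)).prod (MeasurePreserving.id _))
    (fun z => Prod.ext (neg_neg z.1) rfl) ?_ (measurableSet_Ioi.prod MeasurableSet.univ) ?_ hh
  · ext z
    change ((-z.1) ^ 2 + z.2 ^ 2 ≤ r ^ 2 ∧ True ∧ z.2 ∈ S) ↔
      (z.1 ^ 2 + z.2 ^ 2 ≤ r ^ 2 ∧ True ∧ z.2 ∈ S)
    rw [neg_sq]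
  -- The reflected half-plane is the complement only up to the axis, a null set.
  · have h0 : ∀ᵐ z : ℝ × ℝ, z.1 ≠ 0 :=
      Measure.quasiMeasurePreserving_fst.ae (Measure.ae_ne volume 0)
    filter_upwards [h0] with z hz
    simp only [eq_iff_iff]
    change (0 < -z.1 ∧ True) ↔ ¬ (0 < z.1 ∧ True)
    simp only [and_true, not_lt, Left.neg_pos_iff]
    exact ⟨le_of_lt, fun h => lt_of_le_of_ne h hz⟩

theorem setIntegral_disk_inter_swap {r : ℝ} {S T : Set ℝ} {h : ℝ × ℝ → ℝ} :
    ∫ z in disk r ∩ S ×ˢ T, h z = ∫ z in disk r ∩ T ×ˢ S, h z.swap := by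
  have hp : MeasurePreserving (Prod.swap : ℝ × ℝ → ℝ × ℝ) volume volume :=
    Measure.measurePreserving_swap
  rw [← hp.setIntegral_preimage_emb MeasurableEquiv.prodComm.measurableEmbedding h]
  congr 2
  ext z
  simp only [disk, mem_preimage, mem_inter_iff, mem_ofPred_eq, Prod.fst_swap, Prod.snd_swap,
    mem_prod, add_comm]
  tauto

theorem setIntegral_cap {h : ℝ × ℝ → ℝ} (hh : Continuous h) :
    ∫ z in disk π ∩ Ioc 0 (π / √2) ×ˢ Ioc (π / √2) π, h z =
      ∫ u in 0..(π / √2), ∫ v in (π / √2)..(arc u), h (u, v) := by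
  have hInt : IntegrableOn ((disk π).indicator h) (Ioc 0 (π / √2) ×ˢ Ioc (π / √2) π) :=
    ((integrable_indicator_iff (measurableSet_disk π)).2
      (hh.integrableOn_disk pi_pos.le)).integrableOn
  rw [inter_comm, ← setIntegral_indicator (measurableSet_disk π), Measure.volume_eq_prod,
    setIntegral_prod _ hInt, integral_of_le pi_div_sqrt_two_pos.le]
  refine setIntegral_congr_fun measurableSet_Ioc fun u hu => ?_
  have hm := arc_mem (Ioc_subset_Icc_self hu)
  rw [integral_of_le hm.1]
  have e : ∀ v, (disk π).indicator h (u, v) = 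
      (Prod.mk u ⁻¹' disk π).indicator (fun v => h (u, v)) v :=
    fun v => rfl
  simp_rw [e]
  rw [setIntegral_indicator ((measurableSet_disk π).preimage measurable_prodMk_left)]
  congr 2
  have h2 : u ^ 2 ≤ π ^ 2 / 2 := by
    rw [← pi_div_sqrt_two_sq]; exact pow_le_pow_left₀ hu.1.le hu.2 2
  ext v
  simp only [disk, mem_preimage, mem_inter_iff, mem_Ioc, mem_ofPred_eq]
  constructor
  · rintro ⟨⟨h1, -⟩, h3⟩
    exact ⟨h1, le_sqrt_of_sq_le (by linarith)⟩
  · rintro ⟨h1, h3⟩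
    have hv : 0 ≤ v := (pi_div_sqrt_two_pos.trans h1).le
    refine ⟨⟨h1, h3.trans hm.2⟩, ?_⟩
    have := (le_sqrt hv (by nlinarith [sq_nonneg π])).1 h3
    linarith

theorem exists_abs_integral_mul_le {p : ℝ → ℝ} (hp : ContDiff ℝ 1 p) :
    ∃ C, ∀ (N : ℕ) (x : ℝ), |x| ≤ π →
      |∫ u in 0..(π / √2), dirichletKernel N (x - u) * p u| ≤ C := by
  obtain ⟨hd, hc⟩ := contDiff_one_iff_deriv.1 hp
  have hb0 := pi_div_sqrt_two_pos
  have hb1 := pi_div_sqrt_two_le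
  obtain ⟨A, hA⟩ := isCompact_Icc.exists_bound_of_continuousOn
    (hp.continuous.continuousOn (s := Icc 0 (π / √2)))
  obtain ⟨B, hB⟩ := isCompact_Icc.exists_bound_of_continuousOn (hc.continuousOn (s := Icc 0 (π / √2)))
  refine ⟨5 * π * (2 * A + B * (π / √2 - 0)), fun N x hx => ?_⟩
  obtain ⟨hx1, hx2⟩ := abs_le.1 hx
  have := abs_integral_mul_dirichletKernel_comp_le N (y := x) (h := id) (h' := fun _ => 1) hb0.le
    (fun v _ => (hd v).hasDerivAt) (fun v _ => hasDerivAt_id v) hc.continuousOn continuousOn_const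
    hA hB (fun v hv => by
      simp only [id]
      rw [abs_le]; constructor <;> linarith [hv.1, hv.2, pi_pos])
  simp only [id, mul_one] at this
  simpa only [mul_comm (dirichletKernel N _)] using this

/-- The point with both coordinates `π / √2` lies on the circle. Hence the square below it is inside
the disk, and no point of the disk has both coordinates larger; what remains are two caps exchanged
by the diagonal reflection. -/
theorem quadrant_eq : disk π ∩ Ioi 0 ×ˢ Ioi 0 =
    Ioc 0 (π / √2) ×ˢ Ioc 0 (π / √2) ∪ (disk π ∩ Ioc 0 (π / √2) ×ˢ Ioc (π / √2) π ∪
      disk π ∩ Ioc (π / √2) π ×ˢ Ioc 0 (π / √2)) := by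
  have hb := pi_div_sqrt_two_sq
  have hb0 := pi_div_sqrt_two_pos
  ext z
  simp only [disk, mem_inter_iff, mem_union, mem_prod, mem_Ioi, mem_Ioc, mem_ofPred_eq]
  constructor
  · rintro ⟨hz, h1, h2⟩
    have h3 : z.1 ≤ π := abs_le_of_sq_le_sq' (by nlinarith) pi_pos.le |>.2
    have h4 : z.2 ≤ π := abs_le_of_sq_le_sq' (by nlinarith) pi_pos.le |>.2
    rcases le_or_gt z.1 (π / √2) with h5 | h5 <;> rcases le_or_gt z.2 (π / √2) with h6 | h6
    · exact Or.inl ⟨⟨h1, h5⟩, h2, h6⟩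
    · exact Or.inr (Or.inl ⟨hz, ⟨h1, h5⟩, h6, h4⟩)
    · exact Or.inr (Or.inr ⟨hz, ⟨h5, h3⟩, h2, h6⟩)
    · nlinarith
  · rintro (⟨⟨h1, h2⟩, h3, h4⟩ | ⟨h, ⟨h1, h2⟩, h3, h4⟩ | ⟨h, ⟨h1, h2⟩, h3, h4⟩)
    · exact ⟨by nlinarith, h1, h3⟩
    · exact ⟨h, h1, hb0.trans h3⟩
    · exact ⟨h, hb0.trans h1, h3⟩

theorem continuous_dirichletKernel_mul (N : ℕ) (x y : ℝ) {p r : ℝ → ℝ} (hp : Continuous p)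
    (hr : Continuous r) : Continuous fun z : ℝ × ℝ =>
      dirichletKernel N (x - z.1) * dirichletKernel N (y - z.2) * (p z.1 * r z.2) :=
  (((continuous_dirichletKernel N).comp (by fun_prop)).mul
    ((continuous_dirichletKernel N).comp (by fun_prop))).mul
    ((hp.comp continuous_fst).mul (hr.comp continuous_snd))

theorem exists_abs_setIntegral_cap_le {p r : ℝ → ℝ} (hp : ContDiff ℝ 1 p) (hr : ContDiff ℝ 1 r) :
    ∃ C, ∀ (N : ℕ) (x y : ℝ), |x| ≤ π → |y| ≤ π →
      |∫ z in disk π ∩ Ioc 0 (π / √2) ×ˢ Ioc (π / √2) π,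
        dirichletKernel N (x - z.1) * dirichletKernel N (y - z.2) * (p z.1 * r z.2)| ≤ C := by
  obtain ⟨hpd, hpc⟩ := contDiff_one_iff_deriv.1 hp
  obtain ⟨hrd, hrc⟩ := contDiff_one_iff_deriv.1 hr
  obtain ⟨C, hC⟩ := exists_abs_integral_cap_le (fun t => (hpd t).hasDerivAt) hpc
    (fun t => (hrd t).hasDerivAt) hrc
  refine ⟨C, fun N x y hx hy => ?_⟩
  rw [setIntegral_cap (continuous_dirichletKernel_mul N x y hp.continuous hr.continuous)]
  refine (congrArg abs (intervalIntegral.integral_congr fun u _ => ?_)).trans_le (hC N x y hx hy)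
  simp only
  rw [← mul_assoc, ← intervalIntegral.integral_const_mul]
  congr 1; funext v; ring

/-- On the inscribed square the integral is a product of two one-dimensional ones. The cap on the
right becomes the upper cap when the coordinates, and with them `p` and `r`, are exchanged. -/
theorem exists_abs_setIntegral_quadrant_le {p r : ℝ → ℝ} (hp : ContDiff ℝ 1 p)
    (hr : ContDiff ℝ 1 r) :
    ∃ C, ∀ (N : ℕ) (x y : ℝ), |x| ≤ π → |y| ≤ π →
      |∫ z in disk π ∩ Ioi 0 ×ˢ Ioi 0,
        dirichletKernel N (x - z.1) * dirichletKernel N (y - z.2) * (p z.1 * r z.2)| ≤ C := by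
  obtain ⟨C₁, hC₁⟩ := exists_abs_integral_mul_le hp
  obtain ⟨C₂, hC₂⟩ := exists_abs_integral_mul_le hr
  obtain ⟨C₃, hC₃⟩ := exists_abs_setIntegral_cap_le hp hr
  obtain ⟨C₄, hC₄⟩ := exists_abs_setIntegral_cap_le hr hp
  refine ⟨C₁ * C₂ + (C₃ + C₄), fun N x y hx hy => ?_⟩
  have hc := continuous_dirichletKernel_mul N x y hp.continuous hr.continuous
  have hb0 := pi_div_sqrt_two_pos
  have hD := measurableSet_disk π
  have hi1 : IntegrableOn (fun z : ℝ × ℝ =>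
      dirichletKernel N (x - z.1) * dirichletKernel N (y - z.2) * (p z.1 * r z.2))
      (Ioc 0 (π / √2) ×ˢ Ioc 0 (π / √2)) :=
    (hc.continuousOn.integrableOn_compact (isCompact_Icc.prod isCompact_Icc)).mono_set
      (prod_mono Ioc_subset_Icc_self Ioc_subset_Icc_self)
  have hi := hc.integrableOn_disk pi_pos.le
  rw [quadrant_eq, setIntegral_union _ _ hi1 ((hi.mono_set inter_subset_left).union
    (hi.mono_set inter_subset_left)), setIntegral_union _ _ (hi.mono_set inter_subset_left)
    (hi.mono_set inter_subset_left)]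
  · refine (abs_add_le _ _).trans (add_le_add ?_ ((abs_add_le _ _).trans (add_le_add ?_ ?_)))
    · have e : ∀ z : ℝ × ℝ,
          dirichletKernel N (x - z.1) * dirichletKernel N (y - z.2) * (p z.1 * r z.2) =
          (dirichletKernel N (x - z.1) * p z.1) * (dirichletKernel N (y - z.2) * r z.2) :=
        fun z => by ring
      simp_rw [e]
      rw [Measure.volume_eq_prod, setIntegral_prod_mul (fun u => dirichletKernel N (x - u) * p u)
        (fun v => dirichletKernel N (y - v) * r v), ← integral_of_le hb0.le,
        ← integral_of_le hb0.le, abs_mul]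
      exact mul_le_mul (hC₁ N x hx) (hC₂ N y hy) (abs_nonneg _)
        ((abs_nonneg _).trans (hC₁ N x hx))
    · exact hC₃ N x y hx hy
    · rw [setIntegral_disk_inter_swap]
      refine (congrArg abs (MeasureTheory.integral_congr_ae (.of_forall fun z => ?_))).trans_le
        (hC₄ N y x hy hx)
      simp only [Prod.fst_swap, Prod.snd_swap]
      ring
  · rw [disjoint_left]
    rintro z ⟨-, h1, h2⟩ ⟨-, h3, h4⟩
    exact absurd h3.1 (not_lt.2 h1.2)
  · exact hD.inter (measurableSet_Ioc.prod measurableSet_Ioc)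
  · rw [disjoint_left]
    rintro z ⟨h1, h2⟩ (⟨-, -, h4⟩ | ⟨-, h3, -⟩)
    · exact absurd h4.1 (not_lt.2 h2.2)
    · exact absurd h3.1 (not_lt.2 h1.2)
  · exact (hD.inter (measurableSet_Ioc.prod measurableSet_Ioc)).union
      (hD.inter (measurableSet_Ioc.prod measurableSet_Ioc))

/-- Reflecting a coordinate replaces `p` by `t ↦ p (-t)` and, the kernel being even, the point `x`
by `-x`. Both remain admissible, so the quadrant bound applies to each of the four quadrants. -/
theorem exists_abs_setIntegral_disk_le {p r : ℝ → ℝ} (hp : ContDiff ℝ 1 p) (hr : ContDiff ℝ 1 r) :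
    ∃ C, ∀ (N : ℕ) (x y : ℝ), |x| ≤ π → |y| ≤ π →
      |∫ z in disk π,
        dirichletKernel N (x - z.1) * dirichletKernel N (y - z.2) * (p z.1 * r z.2)| ≤ C := by
  have half : ∀ {p r : ℝ → ℝ}, ContDiff ℝ 1 p → ContDiff ℝ 1 r →
      ∃ C, ∀ (N : ℕ) (x y : ℝ), |x| ≤ π → |y| ≤ π →
      |∫ z in disk π ∩ univ ×ˢ Ioi 0,
        dirichletKernel N (x - z.1) * dirichletKernel N (y - z.2) * (p z.1 * r z.2)| ≤ C := by
    intro p r hp hr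
    obtain ⟨C₁, hC₁⟩ := exists_abs_setIntegral_quadrant_le hp hr
    obtain ⟨C₂, hC₂⟩ := exists_abs_setIntegral_quadrant_le (p := fun t => p (-t))
      (hp.comp contDiff_neg) hr
    refine ⟨C₁ + C₂, fun N x y hx hy => ?_⟩
    have hi := (continuous_dirichletKernel_mul N x y hp.continuous
      hr.continuous).integrableOn_disk pi_pos.le
    rw [setIntegral_disk_eq_add_fst (hi.mono_set inter_subset_left)]
    refine (abs_add_le _ _).trans (add_le_add (hC₁ N x y hx hy) ?_)
    refine (congrArg abs (MeasureTheory.integral_congr_ae (.of_forall fun z => ?_))).trans_le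
      (hC₂ N (-x) y (by rwa [abs_neg]) hy)
    simp only
    rw [← dirichletKernel_neg N (-x - z.1)]
    ring_nf
  obtain ⟨C₁, hC₁⟩ := half hr hp
  obtain ⟨C₂, hC₂⟩ := half (p := r) (r := fun t => p (-t)) hr (hp.comp contDiff_neg)
  refine ⟨C₁ + C₂, fun N x y hx hy => ?_⟩
  have hi := (continuous_dirichletKernel_mul N x y hp.continuous
    hr.continuous).integrableOn_disk pi_pos.le
  have hu : disk π = disk π ∩ univ ×ˢ univ := by simp
  rw [hu, setIntegral_disk_eq_add_fst (hi.mono_set inter_subset_left),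
    setIntegral_disk_inter_swap (S := Ioi 0) (T := univ),
    setIntegral_disk_inter_swap (S := Ioi 0) (T := univ)]
  refine (abs_add_le _ _).trans (add_le_add ?_ ?_)
  · refine (congrArg abs (MeasureTheory.integral_congr_ae (.of_forall fun z => ?_))).trans_le
      (hC₁ N y x hy hx)
    simp only [Prod.fst_swap, Prod.snd_swap]
    ring
  · refine (congrArg abs (MeasureTheory.integral_congr_ae (.of_forall fun z => ?_))).trans_le
      (hC₂ N y (-x) hy (by rwa [abs_neg]))
    simp only [Prod.fst_swap, Prod.snd_swap]
    rw [← dirichletKernel_neg N (-x - z.2)]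
    ring_nf

/-- The square partial Fourier sums of a polynomial cut off at the circle inscribed in the period
square are bounded uniformly in the order and in the point. -/
theorem exists_norm_setIntegral_disk_le (P : MvPolynomial (Fin 2) ℂ) :
    ∃ C, ∀ (N : ℕ) (x y : ℝ), |x| ≤ π → |y| ≤ π →
      ‖∫ z in disk π, (dirichletKernel N (x - z.1) * dirichletKernel N (y - z.2) : ℂ) *
        MvPolynomial.eval ![(z.1 : ℂ), (z.2 : ℂ)] P‖ ≤ C := by
  induction P using MvPolynomial.induction_on' with
  | monomial s c =>
    obtain ⟨C, hC⟩ := exists_abs_setIntegral_disk_le (p := fun t => t ^ s 0) (r := fun t => t ^ s 1)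
      (contDiff_id.pow _) (contDiff_id.pow _)
    refine ⟨‖c‖ * C, fun N x y hx hy => ?_⟩
    have e : ∀ z : ℝ × ℝ, (dirichletKernel N (x - z.1) * dirichletKernel N (y - z.2) : ℂ) *
        MvPolynomial.eval ![(z.1 : ℂ), (z.2 : ℂ)] (MvPolynomial.monomial s c) =
        c * ((dirichletKernel N (x - z.1) * dirichletKernel N (y - z.2) *
          (z.1 ^ s 0 * z.2 ^ s 1) : ℝ) : ℂ) := fun z => by
      rw [MvPolynomial.eval_monomial, Finsupp.prod_fintype _ _ (by simp), Fin.prod_univ_two]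
      simp only [Matrix.cons_val_zero, Matrix.cons_val_one]
      push_cast; ring
    simp_rw [e]
    rw [MeasureTheory.integral_const_mul, integral_complex_ofReal, norm_mul]
    gcongr
    rw [Complex.norm_real]
    exact hC N x y hx hy
  | add P Q hP hQ =>
    obtain ⟨C₁, hC₁⟩ := hP
    obtain ⟨C₂, hC₂⟩ := hQ
    refine ⟨C₁ + C₂, fun N x y hx hy => ?_⟩
    have hInt : ∀ P : MvPolynomial (Fin 2) ℂ, IntegrableOn (fun z : ℝ × ℝ =>
        (dirichletKernel N (x - z.1) * dirichletKernel N (y - z.2) : ℂ) *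
        MvPolynomial.eval ![(z.1 : ℂ), (z.2 : ℂ)] P) (disk π) := fun P => by
      refine Continuous.integrableOn_disk ?_ pi_pos.le
      have hk := continuous_dirichletKernel N
      have hP : Continuous fun z : ℝ × ℝ => MvPolynomial.eval ![(z.1 : ℂ), (z.2 : ℂ)] P := by
        refine (MvPolynomial.continuous_eval P).comp (continuous_pi fun i => ?_)
        fin_cases i <;> simp <;> fun_prop
      fun_prop
    simp_rw [map_add, mul_add]
    rw [MeasureTheory.integral_add (hInt P) (hInt Q)]
    exact (norm_add_le _ _).trans (add_le_add (hC₁ N x y hx hy) (hC₂ N x y hx hy))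

/-! ### Radial Zernike polynomials: moments and Hankel transform. -/

theorem prod_erase_range_sub (l i : ℕ) (hi : i ≤ l) :
    ∏ j ∈ (Finset.range (l + 1)).erase i, ((j : ℝ) - i)
      = (-1) ^ i * (i.factorial * (l - i).factorial) := by
  induction l, hi using Nat.le_induction with
  | base =>
    have h : (Finset.range (i + 1)).erase i = Finset.range i := by
      ext j; simp only [Finset.mem_erase, Finset.mem_range]; omega
    rw [h, ← Finset.prod_range_reflect]
    have h2 : ∀ j ∈ Finset.range i, (((i - 1 - j : ℕ) : ℝ) - i) = -1 * ((j + 1 : ℕ) : ℝ) := by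
      intro j hj
      have : j + 1 + (i - 1 - j) = i := by have := Finset.mem_range.1 hj; omega
      have hc : ((j + 1 : ℕ) : ℝ) + ((i - 1 - j : ℕ) : ℝ) = i := by exact_mod_cast this
      linarith
    rw [Finset.prod_congr rfl h2, Finset.prod_mul_distrib, Finset.prod_const, Finset.card_range,
      ← Nat.cast_prod, Finset.prod_range_add_one_eq_factorial]
    simp
  | succ l hl ih =>
    have h : (Finset.range (l + 1 + 1)).erase i
        = insert (l + 1) ((Finset.range (l + 1)).erase i) := by
      ext j; simp only [Finset.mem_erase, Finset.mem_range, Finset.mem_insert]; omega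
    rw [h, Finset.prod_insert (by simp), ih, show l + 1 - i = (l - i) + 1 by omega,
      Nat.factorial_succ]
    push_cast [Nat.cast_sub hl]
    ring

theorem prod_range_add_mul_factorial (q l : ℕ) :
    (∏ i ∈ Finset.range l, ((q : ℝ) + i + 1)) * q.factorial = (q + l).factorial := by
  induction l with
  | zero => simp
  | succ l ih =>
    rw [Finset.prod_range_succ, mul_right_comm, ih, ← add_assoc, Nat.factorial_succ]
    push_cast; ring

/-- A partial fraction identity for ratios of factorials. -/
theorem sum_neg_one_pow_mul_factorial_div (μ l p : ℕ) :
    ∑ i ∈ Finset.range (l + 1), (-1 : ℝ) ^ (l + i) * ((μ + l + i).factorial /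
      (i.factorial * (l - i).factorial * (μ + i).factorial)) / (μ + p + i + 1)
      = p.descFactorial l * (p + μ).factorial / (p + μ + l + 1).factorial := by
  classical
  -- The identity is Lagrange interpolation of the falling factorial of degree `l` at the `l + 1`
  -- nodes `v i`, evaluated at `p`. The denominators on the left are `p - v i`, and the nodal
  -- polynomial at `p` is the quotient of factorials on the right.
  set v : ℕ → ℝ := fun i => -((μ : ℝ) + i + 1) with hv
  have hinj : Set.InjOn v (Finset.range (l + 1)) := by
    intro i _ j _ hij
    simp only [hv] at hij
    exact_mod_cast (by linarith : (i : ℝ) = j)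
  have hdeg : (descPochhammer ℝ l).degree < (Finset.range (l + 1)).card := by
    rw [Finset.card_range]
    refine (Polynomial.degree_le_natDegree).trans_lt ?_
    rw [descPochhammer_natDegree]
    exact_mod_cast Nat.lt_succ_self l
  have hne : ∀ i ∈ Finset.range (l + 1), (p : ℝ) ≠ v i := fun i _ h => by
    simp only [hv] at h
    have : (0 : ℝ) < p + (μ + i + 1) := by positivity
    linarith
  have key := congrArg (Polynomial.eval (p : ℝ)) (Lagrange.eq_interpolate hinj hdeg)
  rw [Lagrange.eval_interpolate_not_at_node _ hne, descPochhammer_eval_eq_descFactorial,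
    Lagrange.eval_nodal] at key
  have hnodal : (∏ i ∈ Finset.range (l + 1), ((p : ℝ) - v i)) * (p + μ).factorial
      = (p + μ + l + 1).factorial := by
    rw [add_assoc (p + μ), ← prod_range_add_mul_factorial (p + μ) (l + 1)]
    congr 1
    refine Finset.prod_congr rfl fun i _ => ?_
    simp only [hv]; push_cast; ring
  rw [eq_div_iff (by positivity), ← hnodal, key, ← mul_assoc]
  congr 1
  rw [mul_comm]
  congr 1
  refine Finset.sum_congr rfl fun i hi => ?_
  have hil : i ≤ l := Nat.lt_succ_iff.1 (Finset.mem_range.1 hi)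
  have hw : Lagrange.nodalWeight (Finset.range (l + 1)) v i
      = ((-1) ^ i * ((i.factorial : ℝ) * (l - i).factorial))⁻¹ := by
    rw [← prod_erase_range_sub l i hil, Lagrange.nodalWeight, Finset.prod_inv_distrib]
    congr 1
    refine Finset.prod_congr rfl fun j _ => ?_
    simp only [hv]; ring
  have hr : (descPochhammer ℝ l).eval (v i) * (μ + i).factorial
      = (-1) ^ l * (μ + l + i).factorial := by
    rw [descPochhammer_eval_eq_prod_range, show μ + l + i = (μ + i) + l by ring,
      ← prod_range_add_mul_factorial (μ + i) l, ← mul_assoc]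
    congr 1
    have : ∀ j ∈ Finset.range l, v i - (j : ℝ) = -1 * (((μ + i : ℕ) : ℝ) + j + 1) := fun j _ => by
      simp only [hv]; push_cast; ring
    rw [Finset.prod_congr rfl this, Finset.prod_mul_distrib, Finset.prod_const, Finset.card_range]
  rw [← eq_div_iff (by positivity)] at hr
  rw [hw, hr]
  have hx : (p : ℝ) - v i = μ + p + i + 1 := by simp only [hv]; ring
  have hs : ((-1 : ℝ) ^ i)⁻¹ = (-1) ^ i := by
    rw [← inv_pow]; norm_num
  rw [hx, mul_inv, hs, pow_add]
  have h0 : (μ + p + i + 1 : ℝ) ≠ 0 := by positivity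
  field_simp

theorem continuous_zernikeRadial (n : ℕ) (m : ℤ) : Continuous (zernikeRadial n m) := by
  unfold zernikeRadial; fun_prop

/-- The moments of the radial Zernike polynomials. -/
theorem integral_pow_mul_zernikeRadial (m : ℤ) (l p : ℕ) :
    ∫ ρ in (0 : ℝ)..1, ρ ^ (2 * p + m.natAbs) * (zernikeRadial (m.natAbs + 2 * l) m ρ * ρ)
      = p.descFactorial l * (p + m.natAbs).factorial / (2 * (p + m.natAbs + l + 1).factorial) := by
  set μ := m.natAbs with hμ
  have e1 : (μ + 2 * l - μ) / 2 = l := by omega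
  have e2 : (μ + 2 * l + μ) / 2 = μ + l := by omega
  have hterm : ∀ ρ : ℝ, ρ ^ (2 * p + μ) * (zernikeRadial (μ + 2 * l) m ρ * ρ)
      = ∑ i ∈ Finset.range (l + 1), (-1 : ℝ) ^ (l + i) * ((μ + l + i).factorial /
      (i.factorial * (l - i).factorial * (μ + i).factorial)) * ρ ^ (2 * (μ + p + i) + 1) := by
    intro ρ
    simp only [zernikeRadial, ← hμ, e1, e2]
    -- Reversing the summation puts the powers in increasing order, as the interpolation identity
    -- requires.
    rw [← Finset.sum_range_reflect, Finset.sum_mul, Finset.mul_sum]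
    refine Finset.sum_congr rfl fun i hi => ?_
    have hil : i ≤ l := Nat.lt_succ_iff.1 (Finset.mem_range.1 hi)
    have a1 : l + 1 - 1 - i = l - i := by omega
    have a2 : μ + 2 * l - (l - i) = μ + l + i := by omega
    have a3 : μ + l - (l - i) = μ + i := by omega
    have a4 : l - (l - i) = i := by omega
    have a5 : μ + 2 * l - 2 * (l - i) = μ + 2 * i := by omega
    rw [a1, a2, a3, a4, a5]
    have hs : (-1 : ℝ) ^ (l - i) = (-1) ^ (l + i) := by
      rw [show l + i = (l - i) + 2 * i by omega, pow_add, pow_mul]; simp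
    rw [hs]
    have hpow : ρ ^ (2 * (μ + p + i) + 1) = ρ ^ (2 * p + μ) * (ρ ^ (μ + 2 * i) * ρ) := by ring
    rw [hpow]
    ring
  simp_rw [hterm]
  rw [intervalIntegral.integral_finsetSum fun i _ => Continuous.intervalIntegrable (by fun_prop) _ _]
  have hInt : ∀ i : ℕ, ∫ ρ in (0 : ℝ)..1, ρ ^ (2 * (μ + p + i) + 1)
      = (1 / 2) * (μ + p + i + 1 : ℝ)⁻¹ := fun i => by
    rw [integral_pow]
    have : (μ + p + i + 1 : ℝ) ≠ 0 := by positivity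
    push_cast
    simp only [one_pow, ne_eq, Nat.add_eq_zero_iff, one_ne_zero, and_false, not_false_eq_true,
      zero_pow, sub_zero]
    rw [show (2 * ((μ : ℝ) + p + i) + 1 + 1) = 2 * (μ + p + i + 1) by ring]
    field_simp
  simp_rw [intervalIntegral.integral_const_mul, hInt]
  have := sum_neg_one_pow_mul_factorial_div μ l p
  rw [mul_comm (2 : ℝ), ← div_div, ← this, Finset.sum_div]
  refine Finset.sum_congr rfl fun i _ => ?_
  ring

theorem summable_besselJ_bound (q : ℕ) (x : ℝ) :
    Summable fun j : ℕ => |x / 2| ^ (2 * j + q) / (j.factorial * (j + q).factorial) := by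
  refine Summable.of_nonneg_of_le (fun j => by positivity) (fun j => ?_)
    ((Real.summable_pow_div_factorial (|x / 2| ^ 2)).mul_left (|x / 2| ^ q))
  rw [pow_add, pow_mul, mul_comm (|x / 2| ^ q), div_mul_eq_mul_div]
  gcongr
  exact le_mul_of_one_le_right (by positivity) (by exact_mod_cast Nat.factorial_pos _)

theorem hasSum_besselJ (q : ℕ) (x : ℝ) :
    HasSum (fun j : ℕ => (-1 : ℝ) ^ j / ((j.factorial : ℝ) * ((j + q).factorial : ℝ)) *
      (x / 2) ^ (2 * j + q)) (besselJ q x) := by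
  refine Summable.hasSum (Summable.of_norm ((summable_besselJ_bound q x).congr fun j => ?_))
  rw [norm_mul, norm_div, norm_pow, norm_pow, norm_neg, norm_one, one_pow, norm_eq_abs, norm_eq_abs,
    abs_of_nonneg (by positivity : (0 : ℝ) ≤ (j.factorial : ℝ) * ((j + q).factorial : ℝ))]
  ring

/-- Every term of the Bessel series of order `n + 1` contains the factor `κ`. Cancelling it gives
one series valid at `κ = 0` too, where only `j = 0` with `n = 0` survives; this absorbs the case
distinction. -/
theorem hasSum_besselQuotient (n : ℕ) (κ : ℝ) :
    HasSum (fun j : ℕ => (-1 : ℝ) ^ j / ((j.factorial : ℝ) * ((j + (n + 1)).factorial : ℝ)) *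
      ((π / 2) ^ (2 * j + (n + 1)) * κ ^ (2 * j + n))) (besselQuotient n κ) := by
  unfold besselQuotient
  split_ifs with hκ hn
  · subst hκ hn
    convert hasSum_single (0 : ℕ) (fun j hj => ?_) using 1
    · simp
    · rw [zero_pow (by omega)]; simp
  · subst hκ
    convert hasSum_zero with j
    rw [zero_pow (by omega)]; simp
  · refine ((hasSum_besselJ (n + 1) (π * κ)).div_const κ).congr_fun ?_
    intro j
    rw [show π * κ / 2 = π / 2 * κ by ring, mul_pow, ← add_assoc (2 * j), pow_succ κ]
    field_simp

/-- The Hankel transform of a radial Zernike polynomial. -/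
theorem integral_besselJ_mul_zernikeRadial (m : ℤ) (l : ℕ) (κ : ℝ) :
    ∫ ρ in (0 : ℝ)..1, besselJ m.natAbs (π * κ * ρ) * (zernikeRadial (m.natAbs + 2 * l) m ρ * ρ)
      = (-1) ^ l * besselQuotient (m.natAbs + 2 * l) κ / π := by
  set μ := m.natAbs with hμ
  obtain ⟨M, hM⟩ := isCompact_Icc.exists_bound_of_continuousOn (s := Icc (0 : ℝ) 1)
    ((continuous_zernikeRadial (μ + 2 * l) m).mul continuous_id).continuousOn
  have h1 : HasSum (fun j : ℕ => ∫ ρ in (0 : ℝ)..1,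
      ((-1 : ℝ) ^ j / ((j.factorial : ℝ) * ((j + μ).factorial : ℝ)) *
      (π * κ * ρ / 2) ^ (2 * j + μ)) * (zernikeRadial (μ + 2 * l) m ρ * ρ))
      (∫ ρ in (0 : ℝ)..1, besselJ μ (π * κ * ρ) * (zernikeRadial (μ + 2 * l) m ρ * ρ)) := by
    refine intervalIntegral.hasSum_integral_of_dominated_convergence
      (fun j _ => |π * κ / 2| ^ (2 * j + μ) / (j.factorial * (j + μ).factorial) * M)
      (fun j => ?_) (fun j => ?_) ?_ ?_ ?_
    · have := continuous_zernikeRadial (μ + 2 * l) m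
      exact Continuous.aestronglyMeasurable (by fun_prop)
    · refine .of_forall fun ρ hρ => ?_
      rw [uIoc_of_le zero_le_one] at hρ
      have hb := hM ρ (Ioc_subset_Icc_self hρ)
      rw [norm_mul]
      refine mul_le_mul ?_ hb (norm_nonneg _) (by positivity)
      rw [norm_mul, norm_div, norm_pow, norm_pow, norm_neg, norm_one, one_pow, norm_eq_abs,
        norm_eq_abs, abs_of_nonneg
        (by positivity : (0 : ℝ) ≤ (j.factorial : ℝ) * ((j + μ).factorial : ℝ)), one_div_mul_eq_div,
        show π * κ * ρ / 2 = π * κ / 2 * ρ by ring, abs_mul]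
      gcongr
      refine mul_le_of_le_one_right (abs_nonneg _) ?_
      rw [abs_of_pos hρ.1]; exact hρ.2
    · exact .of_forall fun ρ _ => (summable_besselJ_bound μ (π * κ)).mul_right M
    · exact intervalIntegrable_const
    · exact .of_forall fun ρ _ => (hasSum_besselJ μ (π * κ * ρ)).mul_right _
  have h2 : ∀ j : ℕ, ∫ ρ in (0 : ℝ)..1,
      ((-1 : ℝ) ^ j / ((j.factorial : ℝ) * ((j + μ).factorial : ℝ)) *
      (π * κ * ρ / 2) ^ (2 * j + μ)) * (zernikeRadial (μ + 2 * l) m ρ * ρ)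
      = (-1 : ℝ) ^ j * j.descFactorial l / (2 * j.factorial * (j + μ + l + 1).factorial) *
        (π * κ / 2) ^ (2 * j + μ) := by
    intro j
    have e : ∀ ρ : ℝ, ((-1 : ℝ) ^ j / ((j.factorial : ℝ) * ((j + μ).factorial : ℝ)) *
      (π * κ * ρ / 2) ^ (2 * j + μ)) * (zernikeRadial (μ + 2 * l) m ρ * ρ) =
      ((-1 : ℝ) ^ j / ((j.factorial : ℝ) * ((j + μ).factorial : ℝ)) * (π * κ / 2) ^ (2 * j + μ)) *
      (ρ ^ (2 * j + μ) * (zernikeRadial (μ + 2 * l) m ρ * ρ)) := fun ρ => by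
      rw [show π * κ * ρ / 2 = π * κ / 2 * ρ by ring, mul_pow]; ring
    simp_rw [e]
    rw [intervalIntegral.integral_const_mul, integral_pow_mul_zernikeRadial, ← hμ]
    field_simp
  simp_rw [h2] at h1
  have h3 := ((hasSum_besselQuotient (μ + 2 * l) κ).mul_left ((-1) ^ l)).div_const π
  have hinj : Function.Injective fun i : ℕ => i + l := add_left_injective l
  -- The terms with `j < l` vanish, because the Zernike polynomial is orthogonal to the
  -- corresponding lower powers. The shift `j = i + l` turns the series of order `|m|` into that of
  -- order `n + 1` and produces the sign `(-1) ^ l`.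
  refine h1.unique ((hinj.hasSum_iff fun j hj => ?_).1 (h3.congr_fun fun i => ?_))
  · have : j < l := by
      by_contra h
      exact hj ⟨j - l, by simp only; omega⟩
    rw [Nat.descFactorial_of_lt this]; simp
  · simp only [Function.comp_def]
    have hd : ((i + l).descFactorial l : ℝ) * i.factorial = (i + l).factorial := by
      have := Nat.factorial_mul_descFactorial (n := i + l) (k := l) (by omega)
      rw [Nat.add_sub_cancel, mul_comm] at this
      exact_mod_cast this
    rw [← eq_div_iff (by positivity)] at hd
    rw [hd, show i + l + μ + l + 1 = i + (μ + 2 * l + 1) by ring,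
      show 2 * (i + l) + μ = 2 * i + (μ + 2 * l) by ring, show π * κ / 2 = π / 2 * κ by ring,
      mul_pow, pow_add (-1 : ℝ) i l, 
      ← add_assoc (2 * i) (μ + 2 * l) 1, pow_succ (π / 2)]
    field_simp

/-! ### The Jacobi–Anger expansion. -/

/-- Both exponentials are expanded and the double series is integrated termwise, under an absolutely
summable bound independent of the angle. Integration over the circle keeps only the diagonal `q - p
= m`. -/
theorem hasSum_integral_exp_mul_exp (A B : ℂ) (m : ℤ) :
    HasSum (fun pq : ℕ × ℕ => if (pq.2 : ℤ) - pq.1 - m = 0 then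
        (A ^ pq.1 / pq.1.factorial * (B ^ pq.2 / pq.2.factorial)) * (2 * π : ℂ) else 0)
      (∫ θ in (0 : ℝ)..(2 * π), Complex.exp (A * Complex.exp (-(Complex.I * θ)) +
        B * Complex.exp (Complex.I * θ)) * Complex.exp (-(Complex.I * m * θ))) := by
  have hexp : ∀ z : ℂ, HasSum (fun p : ℕ => z ^ p / p.factorial) (Complex.exp z) := fun z => by
    rw [Complex.exp_eq_exp_ℂ]; exact NormedSpace.expSeries_div_hasSum_exp z
  have hnsum : ∀ z : ℂ, Summable fun p : ℕ => ‖z‖ ^ p / p.factorial := fun z =>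
    Real.summable_pow_div_factorial _
  have hns : ∀ z : ℂ, Summable fun p : ℕ => ‖z ^ p / (p.factorial : ℂ)‖ := fun z =>
    (hnsum z).congr fun p => by simp only [norm_div, norm_pow, Complex.norm_natCast]
  have hprod : ∀ z w : ℂ, HasSum (fun pq : ℕ × ℕ =>
      z ^ pq.1 / pq.1.factorial * (w ^ pq.2 / pq.2.factorial)) (Complex.exp z * Complex.exp w) :=
    fun z w => HasSum.mul (f := fun p : ℕ => z ^ p / (p.factorial : ℂ))
      (g := fun p : ℕ => w ^ p / (p.factorial : ℂ)) (hexp z) (hexp w)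
      (summable_mul_of_summable_norm (f := fun p : ℕ => z ^ p / (p.factorial : ℂ))
        (g := fun p : ℕ => w ^ p / (p.factorial : ℂ)) (hns z) (hns w))
  have hu : ∀ θ : ℝ, ‖Complex.exp (Complex.I * θ)‖ = 1 := fun θ => by
    rw [mul_comm]; exact Complex.norm_exp_ofReal_mul_I θ
  have hu' : ∀ θ : ℝ, ‖Complex.exp (-(Complex.I * θ))‖ = 1 := fun θ => by
    simpa using hu (-θ)
  have hu'' : ∀ θ : ℝ, ‖Complex.exp (-(Complex.I * m * θ))‖ = 1 := fun θ => by
    have := hu (-(m * θ)); push_cast at this; rw [← this]; ring_nf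
  have hpt : ∀ θ : ℝ, HasSum (fun pq : ℕ × ℕ =>
      ((A * Complex.exp (-(Complex.I * θ))) ^ pq.1 / pq.1.factorial *
        ((B * Complex.exp (Complex.I * θ)) ^ pq.2 / pq.2.factorial)) *
        Complex.exp (-(Complex.I * m * θ)))
      (Complex.exp (A * Complex.exp (-(Complex.I * θ)) + B * Complex.exp (Complex.I * θ)) *
        Complex.exp (-(Complex.I * m * θ))) := fun θ => by
    rw [Complex.exp_add]
    exact (hprod _ _).mul_right _
  have hnn : ∀ z : ℂ, 0 ≤ fun p : ℕ => ‖z‖ ^ p / (p.factorial : ℝ) := fun z p =>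
    div_nonneg (pow_nonneg (norm_nonneg z) p) (Nat.cast_nonneg _)
  have hsum : Summable fun pq : ℕ × ℕ =>
      ‖A‖ ^ pq.1 / (pq.1.factorial : ℝ) * (‖B‖ ^ pq.2 / (pq.2.factorial : ℝ)) :=
    Summable.mul_of_nonneg (f := fun p : ℕ => ‖A‖ ^ p / (p.factorial : ℝ))
      (g := fun p : ℕ => ‖B‖ ^ p / (p.factorial : ℝ)) (hnsum A) (hnsum B) (hnn A) (hnn B)
  have h1 : HasSum (fun pq : ℕ × ℕ => ∫ θ in (0 : ℝ)..(2 * π),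
      ((A * Complex.exp (-(Complex.I * θ))) ^ pq.1 / pq.1.factorial *
        ((B * Complex.exp (Complex.I * θ)) ^ pq.2 / pq.2.factorial)) *
        Complex.exp (-(Complex.I * m * θ)))
      (∫ θ in (0 : ℝ)..(2 * π), Complex.exp (A * Complex.exp (-(Complex.I * θ)) +
        B * Complex.exp (Complex.I * θ)) * Complex.exp (-(Complex.I * m * θ))) := by
    refine intervalIntegral.hasSum_integral_of_dominated_convergence (ι := ℕ × ℕ)
      (F := fun (pq : ℕ × ℕ) (θ : ℝ) => ((A * Complex.exp (-(Complex.I * θ))) ^ pq.1 /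
        pq.1.factorial * ((B * Complex.exp (Complex.I * θ)) ^ pq.2 / pq.2.factorial)) *
        Complex.exp (-(Complex.I * m * θ)))
      (fun pq _ => ‖A‖ ^ pq.1 / pq.1.factorial * (‖B‖ ^ pq.2 / pq.2.factorial))
      (fun pq => ?_) (fun pq => ?_) ?_ ?_ ?_
    · exact Continuous.aestronglyMeasurable (by fun_prop)
    · refine .of_forall fun θ _ => le_of_eq ?_
      simp only [norm_mul, norm_div, norm_pow, hu, hu', hu'', mul_one, Complex.norm_natCast]
    · exact Filter.Eventually.of_forall fun _ _ => hsum
    · exact intervalIntegrable_const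
    · exact Filter.Eventually.of_forall fun θ _ => hpt θ
  refine h1.congr_fun fun pq => ?_
  obtain ⟨p, q⟩ := pq
  have e : ∀ θ : ℝ, ((A * Complex.exp (-(Complex.I * θ))) ^ p / p.factorial *
        ((B * Complex.exp (Complex.I * θ)) ^ q / q.factorial)) *
        Complex.exp (-(Complex.I * m * θ)) = (A ^ p / p.factorial * (B ^ q / q.factorial)) *
        Complex.exp (Complex.I * (((q : ℤ) - p - m : ℤ) : ℂ) * θ) := fun θ => by
    rw [mul_pow, mul_pow, ← Complex.exp_nat_mul, ← Complex.exp_nat_mul]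
    have : Complex.exp (Complex.I * (((q : ℤ) - p - m : ℤ) : ℂ) * θ) =
        Complex.exp (p * -(Complex.I * θ)) * Complex.exp (q * (Complex.I * θ)) *
        Complex.exp (-(Complex.I * m * θ)) := by
      rw [← Complex.exp_add, ← Complex.exp_add]; push_cast; ring_nf
    rw [this]; ring
  simp_rw [e]
  have hi := integral_exp_int_mul ((q : ℤ) - p - m) 0
  rw [zero_add] at hi
  rw [intervalIntegral.integral_const_mul, hi]
  split_ifs <;> simp

/-- The Jacobi–Anger expansion, in integral form. -/
theorem integral_exp_cos_mul_exp (s Φ : ℝ) (m : ℤ) :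
    ∫ θ in (0 : ℝ)..(2 * π), Complex.exp (Complex.I * (s * cos (θ - Φ) : ℝ)) *
        Complex.exp (-(Complex.I * m * θ))
      = 2 * π * Complex.I ^ m.natAbs * Complex.exp (-(Complex.I * m * Φ)) *
        besselJ m.natAbs s := by
  set A : ℂ := Complex.I * (s / 2) * Complex.exp (Complex.I * Φ) with hA
  set B : ℂ := Complex.I * (s / 2) * Complex.exp (-(Complex.I * Φ)) with hB
  set μ := m.natAbs with hμ
  have e : ∀ θ : ℝ, Complex.exp (Complex.I * (s * cos (θ - Φ) : ℝ)) =
      Complex.exp (A * Complex.exp (-(Complex.I * θ)) + B * Complex.exp (Complex.I * θ)) := by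
    intro θ
    congr 1
    rw [hA, hB, mul_assoc, mul_assoc _ _ (Complex.exp (Complex.I * θ)), ← Complex.exp_add,
      ← Complex.exp_add]
    push_cast
    rw [Complex.cos]
    ring_nf
  simp_rw [e]
  have h1 := hasSum_integral_exp_mul_exp A B m
  have h2 := ((Complex.hasSum_ofReal.2 (hasSum_besselJ μ s)).mul_left
    (2 * π * Complex.I ^ μ * Complex.exp (-(Complex.I * m * Φ))))
  refine h1.unique ?_
  have hIpow : ∀ j : ℕ, (Complex.I * (s / 2)) ^ (2 * j + μ) =
      Complex.I ^ μ * ((-1) ^ j * (s / 2 : ℂ) ^ (2 * j + μ)) := fun j => by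
    rw [mul_pow, pow_add Complex.I, pow_mul, Complex.I_sq]; ring
  -- The surviving diagonal starts on one or the other axis according to the sign of `m`. Both cases
  -- give the Bessel series of order `|m|` with the same factor `I ^ |m|`.
  rcases le_total 0 m with hm | hm
  · have hm' : (μ : ℤ) = m := by omega
    have hmc : (m : ℂ) = μ := by exact_mod_cast hm'.symm
    have hinj : Function.Injective fun j : ℕ => (j, j + μ) := fun i j h => (Prod.ext_iff.1 h).1
    refine (hinj.hasSum_iff fun pq hpq => ?_).1 (h2.congr_fun fun j => ?_)
    · refine if_neg fun h => hpq ⟨pq.1, Prod.ext rfl ?_⟩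
      simp only; omega
    · simp only [Function.comp_def]
      rw [if_pos (by push_cast; omega)]
      have hAB : A ^ j * B ^ (j + μ) = (Complex.I * (s / 2)) ^ (2 * j + μ) *
          Complex.exp (-(Complex.I * m * Φ)) := by
        rw [hA, hB, mul_pow (Complex.I * _), mul_pow (Complex.I * _), ← Complex.exp_nat_mul,
          ← Complex.exp_nat_mul, hmc]
        have : Complex.exp (-(Complex.I * μ * Φ)) = Complex.exp (j * (Complex.I * Φ)) *
            Complex.exp ((j + μ : ℕ) * -(Complex.I * Φ)) := by
          rw [← Complex.exp_add]; push_cast; ring_nf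
        rw [this]; ring
      rw [div_mul_div_comm, hAB, hIpow]
      push_cast
      ring
  · have hm' : (μ : ℤ) = -m := by omega
    have hmc : (m : ℂ) = -μ := by
      have : ((μ : ℤ) : ℂ) = ((-m : ℤ) : ℂ) := by rw [hm']
      push_cast at this; rw [this, neg_neg]
    have hinj : Function.Injective fun j : ℕ => (j + μ, j) := fun i j h => (Prod.ext_iff.1 h).2
    refine (hinj.hasSum_iff fun pq hpq => ?_).1 (h2.congr_fun fun j => ?_)
    · refine if_neg fun h => hpq ⟨pq.2, Prod.ext ?_ rfl⟩
      simp only; omega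
    · simp only [Function.comp_def]
      rw [if_pos (by push_cast; omega)]
      have hAB : A ^ (j + μ) * B ^ j = (Complex.I * (s / 2)) ^ (2 * j + μ) *
          Complex.exp (-(Complex.I * m * Φ)) := by
        rw [hA, hB, mul_pow (Complex.I * _), mul_pow (Complex.I * _), ← Complex.exp_nat_mul,
          ← Complex.exp_nat_mul, hmc]
        have : Complex.exp (-(Complex.I * -μ * Φ)) = Complex.exp ((j + μ : ℕ) * (Complex.I * Φ)) *
            Complex.exp (j * -(Complex.I * Φ)) := by
          rw [← Complex.exp_add]; push_cast; ring_nf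
        rw [this]; ring
      rw [div_mul_div_comm, hAB, hIpow]
      push_cast
      ring

/-! ### Fourier–Zernike coefficients of exponential monomials. -/

/-- The exponential monomial of frequency `k` on the square `[-a, a]²`. -/
noncomputable def squareMonomial (a : ℝ) (k : ℤ × ℤ) (x : ℝ × ℝ) : ℂ :=
  Complex.exp (π * Complex.I * (a : ℂ)⁻¹ * (k.1 * x.1 + k.2 * x.2))

/-- The angle differs from `Complex.arg` by a multiple of `2 π`, so the cosine is unaffected. -/
theorem lattice_polar (k : ℤ × ℤ) (θ : ℝ) :
    k.1 * cos θ + k.2 * sin θ = latticeNorm k * cos (θ - latticeAngle k) := by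
  set z : ℂ := ⟨k.1, k.2⟩ with hz
  have hnorm : latticeNorm k = ‖z‖ := by
    rw [Complex.norm_def, Complex.normSq_apply, latticeNorm]; congr 1; simp [hz]; ring
  have hang : latticeAngle k = z.arg - (toIcoDiv two_pi_pos 0 z.arg : ℤ) * (2 * π) := by
    rw [latticeAngle, ← self_sub_toIcoDiv_zsmul, zsmul_eq_mul]
  have hc : cos (θ - latticeAngle k) = cos (θ - z.arg) := by
    rw [hang, sub_sub_eq_add_sub, add_sub_right_comm]
    exact cos_add_int_mul_two_pi _ _
  rw [hc, hnorm, cos_sub, mul_add]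
  have h1 : ‖z‖ * cos z.arg = k.1 := Complex.norm_mul_cos_arg z
  have h2 : ‖z‖ * sin z.arg = k.2 := Complex.norm_mul_sin_arg z
  rw [← h1, ← h2]; ring

theorem exists_radial_index {n : ℕ} {m : ℤ} (hmn : m.natAbs ≤ n) (hpar : n ≡ m.natAbs [MOD 2]) :
    ∃ l, n = m.natAbs + 2 * l := by
  obtain ⟨l, hl⟩ := (Nat.modEq_iff_dvd' hmn).1 hpar.symm
  exact ⟨l, by omega⟩

/-- The constant of `convFactor` depends only on `|m|`: for negative `m` the extra sign `(-1) ^ |m|`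
turns `I ^ (-|m|)` into `I ^ |m|`. -/
theorem I_zpow_mul_neg_one_zpow (m : ℤ) (l : ℕ) :
    Complex.I ^ m * (-1 : ℂ) ^ ((((m.natAbs + 2 * l : ℕ) : ℤ) - m) / 2)
      = Complex.I ^ m.natAbs * (-1) ^ l := by
  rcases Int.natAbs_eq m with hm | hm
  · have h : (((m.natAbs + 2 * l : ℕ) : ℤ) - m) / 2 = (l : ℤ) := by omega
    rw [h, zpow_natCast]
    congr 1
    conv_lhs => rw [hm]
    exact zpow_natCast _ _
  · have h : (((m.natAbs + 2 * l : ℕ) : ℤ) - m) / 2 = ((m.natAbs + l : ℕ) : ℤ) := by omega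
    rw [h, zpow_natCast, pow_add, ← mul_assoc]
    congr 1
    conv_lhs => enter [1]; rw [hm]
    rw [zpow_neg, zpow_natCast, ← inv_pow, Complex.inv_I, ← mul_pow]
    congr 1; ring

/-- On the circle of radius `r` the monomial is a plane wave with phase `π |k| (r / a) cos (θ - Φ)`,
so Jacobi–Anger evaluates the angular integral. After scaling to the unit interval the radial
integral is the Hankel transform of the Zernike polynomial. -/
theorem zernikeCoeff_squareMonomial {a : ℝ} (ha : 0 < a) (k : ℤ × ℤ) {n : ℕ} {m : ℤ}
    (hmn : m.natAbs ≤ n) (hpar : n ≡ m.natAbs [MOD 2]) :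
    zernikeCoeff a n m (squareMonomial a k) = 4 * a ^ 2 * convFactor a k n m := by
  obtain ⟨l, rfl⟩ := exists_radial_index hmn hpar
  set n := m.natAbs + 2 * l with hn
  set κ := latticeNorm k with hκ
  set Φ := latticeAngle k with hΦ
  have hinner : ∀ r : ℝ, ∫ θ in (0 : ℝ)..(2 * π), squareMonomial a k (r * cos θ, r * sin θ) *
      starRingEnd ℂ (fourierZernike a n m r θ) * (r : ℂ) =
      (2 * π * Complex.I ^ m.natAbs * Complex.exp (-(Complex.I * m * Φ))) *
      ((a⁻¹ * √(((n : ℝ) + 1) / π) * (besselJ m.natAbs (π * κ * (a⁻¹ * r)) *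
        (zernikeRadial n m (a⁻¹ * r) * r)) : ℝ) : ℂ) := by
    intro r
    have e : ∀ θ : ℝ, squareMonomial a k (r * cos θ, r * sin θ) *
        starRingEnd ℂ (fourierZernike a n m r θ) * (r : ℂ) =
        ((a⁻¹ * √(((n : ℝ) + 1) / π) * zernikeRadial n m (a⁻¹ * r) * r : ℝ) : ℂ) *
        (Complex.exp (Complex.I * ((π * κ * (a⁻¹ * r)) * cos (θ - Φ) : ℝ)) *
        Complex.exp (-(Complex.I * m * θ))) := by
      intro θ
      have h1 : squareMonomial a k (r * cos θ, r * sin θ) =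
          Complex.exp (Complex.I * ((π * κ * (a⁻¹ * r)) * cos (θ - Φ) : ℝ)) := by
        rw [squareMonomial]
        congr 1
        have := lattice_polar k θ
        rw [← hκ, ← hΦ] at this
        rw [show π * κ * (a⁻¹ * r) * cos (θ - Φ) = π * (a⁻¹ * r) * (κ * cos (θ - Φ)) by ring,
          ← this]
        push_cast; ring
      have h2 : starRingEnd ℂ (Complex.exp (Complex.I * m * θ)) =
          Complex.exp (-(Complex.I * m * θ)) := by
        rw [← Complex.exp_conj]; simp
      rw [h1, fourierZernike, map_mul, h2, Complex.conj_ofReal]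
      push_cast; ring
    simp_rw [e]
    rw [intervalIntegral.integral_const_mul, integral_exp_cos_mul_exp]
    push_cast; ring
  rw [zernikeCoeff]
  simp_rw [hinner]
  rw [intervalIntegral.integral_const_mul, intervalIntegral.integral_ofReal,
    intervalIntegral.integral_const_mul]
  have hsub : ∫ r in (0 : ℝ)..a, besselJ m.natAbs (π * κ * (a⁻¹ * r)) *
      (zernikeRadial n m (a⁻¹ * r) * r) = a ^ 2 * ((-1) ^ l * besselQuotient n κ / π) := by
    have h := intervalIntegral.integral_comp_mul_left (a := 0) (b := a) (c := a⁻¹) (fun ρ =>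
      besselJ m.natAbs (π * κ * ρ) * (zernikeRadial n m ρ * ρ)) (inv_ne_zero ha.ne')
    rw [mul_zero, inv_mul_cancel₀ ha.ne', integral_besselJ_mul_zernikeRadial, inv_inv,
      smul_eq_mul] at h
    rw [show a ^ 2 * ((-1) ^ l * besselQuotient n κ / π)
      = a * (a * ((-1) ^ l * besselQuotient n κ / π)) by ring, ← h,
      ← intervalIntegral.integral_const_mul]
    congr 1; funext r
    field_simp
  rw [hsub, convFactor, I_zpow_mul_neg_one_zpow, sqrt_div (by positivity), ← hκ, ← hΦ]
  have hπs : ((√π : ℝ) : ℂ) ≠ 0 := by exact_mod_cast (sqrt_pos.2 pi_pos).ne'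
  have hπ0 : (π : ℂ) ≠ 0 := by exact_mod_cast pi_ne_zero
  have ha0 : (a : ℂ) ≠ 0 := by exact_mod_cast ha.ne'
  push_cast
  field_simp
  ring

/-! ### The cut-off Zernike function and the uniform bound of its partial sums. -/

open scoped Pointwise

/-- Each term is a multiple of `r ^ (n - 2 j) * exp (-i m θ)`, that is, of a power of `x ^ 2 + y ^
2` times the `|m|`-th power of `x + i y` or `x - i y`. Being a polynomial is what makes the bound
for double Dirichlet integrals applicable. -/
theorem exists_mvPolynomial_eval_eq_conj_fourierZernike (a : ℝ) {n : ℕ} {m : ℤ}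
    (hmn : m.natAbs ≤ n) (hpar : n ≡ m.natAbs [MOD 2]) :
    ∃ P : MvPolynomial (Fin 2) ℂ, ∀ r θ : ℝ,
      MvPolynomial.eval ![((r * cos θ : ℝ) : ℂ), ((r * sin θ : ℝ) : ℂ)] P =
        starRingEnd ℂ (fourierZernike a n m r θ) := by
  obtain ⟨l, rfl⟩ := exists_radial_index hmn hpar
  set μ := m.natAbs with hμ
  -- `ε` is the opposite of the sign of `m` and chooses between `x + i y` and `x - i y`.
  obtain ⟨ε, hε, hεm⟩ : ∃ ε : ℝ, ε ^ 2 = 1 ∧ ε * μ = -m := by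
    rcases Int.natAbs_eq m with h | h
    · refine ⟨-1, by norm_num, ?_⟩
      have : (m : ℝ) = μ := by
        have h' := congrArg (Int.cast : ℤ → ℝ) h
        rwa [Int.cast_natCast] at h'
      rw [this]; ring
    · refine ⟨1, by norm_num, ?_⟩
      have : (m : ℝ) = -μ := by
        have h' := congrArg (Int.cast : ℤ → ℝ) h
        rwa [Int.cast_neg, Int.cast_natCast] at h'
      rw [this]; ring
  set c : ℕ → ℝ := fun j => a⁻¹ * √((((μ + 2 * l : ℕ) : ℝ) + 1) / π) * ((-1 : ℝ) ^ j *
      (((μ + 2 * l - j).factorial : ℝ) /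
        ((j.factorial : ℝ) * (((μ + 2 * l + μ) / 2 - j).factorial : ℝ) *
          (((μ + 2 * l - μ) / 2 - j).factorial : ℝ))) * a⁻¹ ^ (μ + 2 * l - 2 * j)) with hc
  refine ⟨∑ j ∈ Finset.range (l + 1), MvPolynomial.C (c j : ℂ) *
    ((MvPolynomial.X 0 ^ 2 + MvPolynomial.X 1 ^ 2) ^ (l - j) *
      (MvPolynomial.X 0 + MvPolynomial.C (ε * Complex.I) * MvPolynomial.X 1) ^ μ), fun r θ => ?_⟩
  have hexp : Complex.exp (-(Complex.I * m * θ)) =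
      (cos θ + ε * Complex.I * sin θ : ℂ) ^ μ := by
    have h1 : (cos θ + ε * Complex.I * sin θ : ℂ) = Complex.exp ((ε * θ : ℝ) * Complex.I) := by
      rw [Complex.exp_mul_I, ← Complex.ofReal_cos, ← Complex.ofReal_sin]
      rcases sq_eq_one_iff.1 hε with h | h
      all_goals (subst h; simp [mul_comm])
    have hc' : (m : ℂ) = -(ε * μ : ℝ) := by rw [hεm]; push_cast; ring
    rw [h1, ← Complex.exp_nat_mul, hc']
    congr 1; push_cast; ring
  have hconj : starRingEnd ℂ (Complex.exp (Complex.I * m * θ)) =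
      Complex.exp (-(Complex.I * m * θ)) := by
    rw [← Complex.exp_conj]; simp
  rw [fourierZernike, map_mul (starRingEnd ℂ), Complex.conj_ofReal, hconj, hexp, zernikeRadial, ← hμ,
    show (μ + 2 * l - μ) / 2 = l by omega]
  simp only [map_sum, map_mul, map_pow, map_add, MvPolynomial.eval_C, MvPolynomial.eval_X,
    Matrix.cons_val_zero, Matrix.cons_val_one]
  rw [Finset.mul_sum, Complex.ofReal_sum, Finset.sum_mul]
  refine Finset.sum_congr rfl fun j hj => ?_
  have hjl : j ≤ l := Nat.lt_succ_iff.1 (Finset.mem_range.1 hj)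
  have h2 : (((r * cos θ : ℝ) : ℂ) ^ 2 + ((r * sin θ : ℝ) : ℂ) ^ 2) = (r : ℂ) ^ 2 := by
    have : (r * cos θ) ^ 2 + (r * sin θ) ^ 2 = r ^ 2 := by
      linear_combination r ^ 2 * cos_sq_add_sin_sq θ
    exact_mod_cast this
  have h3 : (((r * cos θ : ℝ) : ℂ) + ε * Complex.I * ((r * sin θ : ℝ) : ℂ)) =
      r * (cos θ + ε * Complex.I * sin θ) := by
    push_cast; ring
  simp only [hc]
  rw [h2, h3, mul_pow (r : ℂ), ← pow_mul, mul_pow a⁻¹,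
    show μ + 2 * l - 2 * j = 2 * (l - j) + μ by omega, show (μ + 2 * l - μ) / 2 = l by omega,
    pow_add r]
  push_cast
  ring

/-- Integration over a disk in polar coordinates. -/
theorem setIntegral_disk_eq_polar {a : ℝ} (ha : 0 < a) {h : ℝ × ℝ → ℂ}
    (hh : IntegrableOn h (disk a)) :
    ∫ x in disk a, h x =
      ∫ r in (0 : ℝ)..a, ∫ θ in (0 : ℝ)..(2 * π), h (r * cos θ, r * sin θ) * (r : ℂ) := by
  have hD := measurableSet_disk a
  have hi : Integrable ((disk a).indicator h) := (integrable_indicator_iff hD).2 hh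
  have htm : MeasurableSet polarCoord.target := polarCoord.open_target.measurableSet
  have hInt : IntegrableOn
      (fun p : ℝ × ℝ => p.1 • (disk a).indicator h (polarCoord.symm p)) polarCoord.target := by
    have := (integrableOn_image_iff_integrableOn_abs_det_fderiv_smul volume htm
      (fun p _ => (hasFDerivAt_polarCoord_symm p).hasFDerivWithinAt) polarCoord.symm.injOn
      ((disk a).indicator h)).1 hi.integrableOn
    refine this.congr_fun (fun p hp => ?_) htm
    simp only [det_fderivPolarCoordSymm, abs_of_pos (show 0 < p.1 from hp.1)]
  rw [← MeasureTheory.integral_indicator hD, ← integral_comp_polarCoord_symm]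
  rw [polarCoord_target] at hInt ⊢
  rw [Measure.volume_eq_prod, setIntegral_prod _ hInt]
  have hin : ∀ r ∈ Ioi (0 : ℝ), ∫ θ in Ioo (-π) π,
      r • (disk a).indicator h (polarCoord.symm (r, θ)) = (Iic a).indicator (fun r =>
        ∫ θ in (0 : ℝ)..(2 * π), h (r * cos θ, r * sin θ) * (r : ℂ)) r := by
    intro r hr
    have hmem : ∀ θ : ℝ, (r * cos θ, r * sin θ) ∈ disk a ↔ r ≤ a := fun θ => by
      have : (r * cos θ) ^ 2 + (r * sin θ) ^ 2 = r ^ 2 := by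
        linear_combination r ^ 2 * cos_sq_add_sin_sq θ
      change (r * cos θ) ^ 2 + (r * sin θ) ^ 2 ≤ a ^ 2 ↔ r ≤ a
      rw [this]
      exact pow_le_pow_iff_left₀ (le_of_lt hr) ha.le two_ne_zero
    by_cases hra : r ≤ a
    · rw [indicator_of_mem (show r ∈ Iic a from hra)]
      have hper : Function.Periodic (fun θ => h (r * cos θ, r * sin θ) * (r : ℂ)) (2 * π) :=
        fun θ => by simp only [cos_add_two_pi, sin_add_two_pi]
      have h1 := hper.intervalIntegral_add_eq (-π) 0
      rw [zero_add, show -π + 2 * π = π by ring, integral_of_le (by linarith [pi_pos]),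
        integral_Ioc_eq_integral_Ioo] at h1
      rw [← h1]
      refine setIntegral_congr_fun measurableSet_Ioo fun θ _ => ?_
      simp only [polarCoord_symm_apply]
      rw [indicator_of_mem ((hmem θ).2 hra), Complex.real_smul, mul_comm]
    · rw [indicator_of_notMem (show r ∉ Iic a from hra)]
      refine integral_eq_zero_of_ae (.of_forall fun θ => ?_)
      simp only [polarCoord_symm_apply, Pi.zero_apply]
      rw [indicator_of_notMem (fun hm => hra ((hmem θ).1 hm)), smul_zero]
  rw [setIntegral_congr_fun measurableSet_Ioi hin, setIntegral_indicator measurableSet_Iic,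
    Ioi_inter_Iic, integral_of_le ha.le]

section zernikeCoeff

variable {a : ℝ} {n : ℕ} {m : ℤ} {P : MvPolynomial (Fin 2) ℂ}

theorem continuous_eval_pair (P : MvPolynomial (Fin 2) ℂ) :
    Continuous fun z : ℝ × ℝ => MvPolynomial.eval ![(z.1 : ℂ), (z.2 : ℂ)] P := by
  refine (MvPolynomial.continuous_eval P).comp (continuous_pi fun i => ?_)
  fin_cases i <;> simp <;> fun_prop

theorem isCompact_disk {r : ℝ} (hr : 0 ≤ r) : IsCompact (disk r) :=
  (isCompact_Icc.prod isCompact_Icc).of_isClosed_subset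
    (isClosed_le (by fun_prop) (by fun_prop)) (disk_subset_Icc hr)

theorem zernikeCoeff_eq_setIntegral (ha : 0 < a)
    (hP : ∀ r θ : ℝ, MvPolynomial.eval ![((r * cos θ : ℝ) : ℂ), ((r * sin θ : ℝ) : ℂ)] P =
        starRingEnd ℂ (fourierZernike a n m r θ)) {f : ℝ × ℝ → ℂ} (hf : IntegrableOn f (disk a)) :
    zernikeCoeff a n m f =
      ∫ z in disk a, f z * MvPolynomial.eval ![(z.1 : ℂ), (z.2 : ℂ)] P := by
  rw [setIntegral_disk_eq_polar ha
    (hf.mul_continuousOn (continuous_eval_pair P).continuousOn (isCompact_disk ha.le))]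
  simp only [hP, zernikeCoeff]

theorem continuous_squareMonomial (a : ℝ) (k : ℤ × ℤ) : Continuous (squareMonomial a k) := by
  unfold squareMonomial; fun_prop

theorem norm_squareMonomial (a : ℝ) (k : ℤ × ℤ) (x : ℝ × ℝ) : ‖squareMonomial a k x‖ = 1 := by
  have : (π * Complex.I * (a : ℂ)⁻¹ * (k.1 * x.1 + k.2 * x.2) : ℂ) =
      ((π * a⁻¹ * (k.1 * x.1 + k.2 * x.2) : ℝ) : ℂ) * Complex.I := by push_cast; ring
  rw [squareMonomial, this, Complex.norm_exp_ofReal_mul_I]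

theorem squareMonomial_add (a : ℝ) (k l : ℤ × ℤ) (x : ℝ × ℝ) :
    squareMonomial a (k + l) x = squareMonomial a k x * squareMonomial a l x := by
  simp only [squareMonomial, ← Complex.exp_add, Prod.fst_add, Prod.snd_add]
  push_cast; ring_nf

theorem setIntegral_squareMonomial_mul_eval (ha : 0 < a) (hmn : m.natAbs ≤ n)
    (hpar : n ≡ m.natAbs [MOD 2])
    (hP : ∀ r θ : ℝ, MvPolynomial.eval ![((r * cos θ : ℝ) : ℂ), ((r * sin θ : ℝ) : ℂ)] P =
        starRingEnd ℂ (fourierZernike a n m r θ)) (k : ℤ × ℤ) :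
    ∫ z in disk a, squareMonomial a k z * MvPolynomial.eval ![(z.1 : ℂ), (z.2 : ℂ)] P =
      4 * a ^ 2 * convFactor a k n m := by
  rw [← zernikeCoeff_squareMonomial ha k hmn hpar,
    zernikeCoeff_eq_setIntegral ha hP ((continuous_squareMonomial a k).integrableOn_disk ha.le)]

/-- This writes the square partial sum of a Fourier series as an integral against two Dirichlet
kernels. -/
theorem sum_squareMonomial_mul (a : ℝ) (N : ℕ) (x z : ℝ × ℝ) :
    ∑ k ∈ latticeSquare N, squareMonomial a k z * squareMonomial a (-k) x =
      dirichletKernel N (π / a * x.1 - π / a * z.1) *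
        dirichletKernel N (π / a * x.2 - π / a * z.2) := by
  rw [← dirichletKernel_neg N (π / a * x.1 - π / a * z.1),
    ← dirichletKernel_neg N (π / a * x.2 - π / a * z.2), dirichletKernel_eq_sum_exp,
    dirichletKernel_eq_sum_exp, Finset.sum_mul_sum, latticeSquare, Finset.sum_product]
  refine Finset.sum_congr rfl fun i _ => Finset.sum_congr rfl fun j _ => ?_
  simp only [squareMonomial, ← Complex.exp_add, Prod.neg_mk]
  congr 1; push_cast; ring

theorem smul_disk {s : ℝ} (hs : 0 < s) (r : ℝ) : s • disk r = disk (s * r) := by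
  ext z
  rw [mem_smul_set_iff_inv_smul_mem₀ hs.ne']
  simp only [disk, mem_ofPred_eq, Prod.smul_fst, Prod.smul_snd, smul_eq_mul, mul_pow]
  rw [← mul_add, inv_pow, inv_mul_le_iff₀ (by positivity)]

/-- The square partial sums of the Fourier series of a Fourier–Zernike basis function, extended
by zero from the disk to the period square, are uniformly bounded. -/
theorem exists_norm_sum_convFactor_le (ha : 0 < a) (hmn : m.natAbs ≤ n)
    (hpar : n ≡ m.natAbs [MOD 2]) :
    ∃ C, ∀ (N : ℕ) (x : ℝ × ℝ), |x.1| ≤ a → |x.2| ≤ a →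
      ‖∑ k ∈ latticeSquare N, convFactor a k n m * squareMonomial a (-k) x‖ ≤ C := by
  obtain ⟨P, hP⟩ := exists_mvPolynomial_eval_eq_conj_fourierZernike a hmn hpar
  set s := a / π with hs
  have hs0 : 0 < s := by positivity
  obtain ⟨C, hC⟩ := exists_norm_setIntegral_disk_le
    (MvPolynomial.aeval (fun i => MvPolynomial.C (s : ℂ) * MvPolynomial.X i) P)
  have ha0 : (a : ℂ) ≠ 0 := by exact_mod_cast ha.ne'
  refine ⟨‖(4 * a ^ 2 : ℂ)⁻¹‖ * (s ^ 2 * C), fun N x hx1 hx2 => ?_⟩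
  have hcoef : ∀ k, convFactor a k n m = (4 * a ^ 2 : ℂ)⁻¹ * ∫ z in disk a,
      squareMonomial a k z * MvPolynomial.eval ![(z.1 : ℂ), (z.2 : ℂ)] P := fun k => by
    rw [setIntegral_squareMonomial_mul_eval ha hmn hpar hP]
    field_simp
  have hsum : ∑ k ∈ latticeSquare N, convFactor a k n m * squareMonomial a (-k) x =
      (4 * a ^ 2 : ℂ)⁻¹ * ∫ z in disk a, (dirichletKernel N (π / a * x.1 - π / a * z.1) *
        dirichletKernel N (π / a * x.2 - π / a * z.2) : ℂ) *
        MvPolynomial.eval ![(z.1 : ℂ), (z.2 : ℂ)] P := by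
    simp_rw [hcoef, ← sum_squareMonomial_mul, Finset.sum_mul]
    rw [MeasureTheory.integral_finsetSum, Finset.mul_sum]
    · refine Finset.sum_congr rfl fun k _ => ?_
      rw [mul_assoc, ← MeasureTheory.integral_mul_const]
      congr 2; funext z; ring
    · intro k _
      refine Continuous.integrableOn_disk ?_ ha.le
      exact ((continuous_squareMonomial a k).mul continuous_const).mul (continuous_eval_pair P)
  -- The dilation by `s = a / π` brings the disk to radius `π`; the plane contributes `s ^ 2`, and
  -- the polynomial is precomposed with the dilation.
  have hscale : ∫ z in disk a, (dirichletKernel N (π / a * x.1 - π / a * z.1) *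
        dirichletKernel N (π / a * x.2 - π / a * z.2) : ℂ) *
        MvPolynomial.eval ![(z.1 : ℂ), (z.2 : ℂ)] P =
      (s ^ 2 : ℝ) • ∫ z in disk π, (dirichletKernel N (π / a * x.1 - z.1) *
        dirichletKernel N (π / a * x.2 - z.2) : ℂ) *
        MvPolynomial.eval ![(z.1 : ℂ), (z.2 : ℂ)]
          (MvPolynomial.aeval (fun i => MvPolynomial.C (s : ℂ) * MvPolynomial.X i) P) := by
    have hsd : disk a = s • disk π := by
      rw [smul_disk hs0, hs, div_mul_cancel₀ _ pi_ne_zero]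
    have h := Measure.setIntegral_comp_smul_of_pos (volume : Measure (ℝ × ℝ))
      (fun z : ℝ × ℝ => (dirichletKernel N (π / a * x.1 - π / a * z.1) *
        dirichletKernel N (π / a * x.2 - π / a * z.2) : ℂ) *
        MvPolynomial.eval ![(z.1 : ℂ), (z.2 : ℂ)] P) (disk π) hs0
    have hfr : Module.finrank ℝ (ℝ × ℝ) = 2 := by simp
    rw [hfr, ← hsd, eq_inv_smul_iff₀ (by positivity)] at h
    rw [← h]
    congr 2
    funext z
    have e : ∀ t : ℝ, π / a * (s * t) = t := fun t => by rw [hs]; field_simp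
    simp only [Prod.smul_fst, Prod.smul_snd, smul_eq_mul, e]
    congr 1
    rw [← MvPolynomial.coe_aeval_eq_eval, ← MvPolynomial.coe_aeval_eq_eval]
    simp only [RingHom.coe_coe]
    rw [← AlgHom.comp_apply, MvPolynomial.comp_aeval]
    congr 2
    funext i
    fin_cases i <;> simp
  have hxb : ∀ t : ℝ, |t| ≤ a → |π / a * t| ≤ π := fun t ht => by
    rw [abs_mul, abs_of_pos (by positivity), div_mul_eq_mul_div, div_le_iff₀ ha]
    gcongr
  rw [hsum, hscale, norm_mul, norm_smul, norm_eq_abs, abs_of_pos (by positivity : 0 < s ^ 2)]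
  gcongr
  exact hC N _ _ (hxb _ hx1) (hxb _ hx2)

end zernikeCoeff

/-! ### Density of trigonometric polynomials in `L¹` of the period square. -/

/-- The half-open period square `(-a, a]²`. -/
def periodSquare (a : ℝ) : Set (ℝ × ℝ) := Ioc (-a) a ×ˢ Ioc (-a) a

theorem measurableSet_periodSquare (a : ℝ) : MeasurableSet (periodSquare a) :=
  measurableSet_Ioc.prod measurableSet_Ioc

theorem volume_periodSquare_lt_top (a : ℝ) : volume (periodSquare a) < ⊤ :=
  (measure_mono (prod_mono Ioc_subset_Icc_self Ioc_subset_Icc_self)).trans_lt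
    (isCompact_Icc.prod isCompact_Icc).measure_lt_top

theorem Continuous.integrableOn_periodSquare {h : ℝ × ℝ → ℂ} (hh : Continuous h) (a : ℝ) :
    IntegrableOn h (periodSquare a) :=
  (hh.continuousOn.integrableOn_compact (isCompact_Icc.prod isCompact_Icc)).mono_set
    (prod_mono Ioc_subset_Icc_self Ioc_subset_Icc_self)

theorem continuous_of_mem_span_squareMonomial {a : ℝ} {t : ℝ × ℝ → ℂ}
    (ht : t ∈ Submodule.span ℂ (range (squareMonomial a))) : Continuous t := by
  induction ht using Submodule.span_induction with
  | mem t h => obtain ⟨k, rfl⟩ := h; exact continuous_squareMonomial a k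
  | zero => exact continuous_const
  | add t u _ _ ht hu => exact ht.add hu
  | smul c t _ ht => exact ht.const_smul c

/-- The projection of the plane to the torus with period square `(-a, a]²`. -/
noncomputable def torusProj (a : ℝ) (x : ℝ × ℝ) : UnitAddTorus (Fin 2) :=
  ![((x.1 / (2 * a) : ℝ) : UnitAddCircle), ((x.2 / (2 * a) : ℝ) : UnitAddCircle)]

/-- The section of `torusProj a` with values in the period square. -/
noncomputable def torusSection (a : ℝ) (θ : UnitAddTorus (Fin 2)) : ℝ × ℝ :=
  (2 * a * (AddCircle.measurableEquivIoc 1 (-1 / 2) (θ 0) : ℝ),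
    2 * a * (AddCircle.measurableEquivIoc 1 (-1 / 2) (θ 1) : ℝ))

theorem continuous_torusProj (a : ℝ) : Continuous (torusProj a) := by
  have hq : Continuous fun t : ℝ => (t : UnitAddCircle) := AddCircle.continuous_mk' 1
  refine continuous_pi fun i => ?_
  fin_cases i
  · exact hq.comp (continuous_fst.div_const _)
  · exact hq.comp (continuous_snd.div_const _)

theorem measurable_torusSection (a : ℝ) : Measurable (torusSection a) := by
  unfold torusSection
  have h : Measurable fun θ : UnitAddCircle =>
      (AddCircle.measurableEquivIoc 1 (-1 / 2) θ : ℝ) :=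
    measurable_subtype_coe.comp (AddCircle.measurableEquivIoc 1 (-1 / 2)).measurable
  have hi : ∀ i : Fin 2, Measurable fun θ : UnitAddTorus (Fin 2) =>
      (AddCircle.measurableEquivIoc 1 (-1 / 2) (θ i) : ℝ) := fun i => h.comp (measurable_pi_apply i)
  exact ((hi 0).const_mul _).prodMk ((hi 1).const_mul _)

theorem torusSection_torusProj {a : ℝ} (ha : 0 < a) {x : ℝ × ℝ} (hx : x ∈ periodSquare a) :
    torusSection a (torusProj a x) = x := by
  have key : ∀ t ∈ Ioc (-a) a,
      2 * a * (AddCircle.measurableEquivIoc 1 (-1 / 2) ((t / (2 * a) : ℝ) : UnitAddCircle) : ℝ)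
        = t := fun t ht => by
    have hm : t / (2 * a) ∈ Ioc (-1 / 2 : ℝ) (-1 / 2 + 1) := by
      constructor
      · rw [lt_div_iff₀ (by positivity)]; linarith [ht.1]
      · rw [div_le_iff₀ (by positivity)]; linarith [ht.2]
    have : (AddCircle.measurableEquivIoc 1 (-1 / 2) ((t / (2 * a) : ℝ) : UnitAddCircle) : ℝ)
        = t / (2 * a) := congrArg Subtype.val (AddCircle.equivIoc_coe_eq hm)
    rw [this]; field_simp
  exact Prod.ext (key _ hx.1) (key _ hx.2)

theorem mFourier_torusProj (a : ℝ) (n : Fin 2 → ℤ) (x : ℝ × ℝ) :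
    UnitAddTorus.mFourier n (torusProj a x) = squareMonomial a (n 0, n 1) x := by
  simp only [UnitAddTorus.mFourier, ContinuousMap.coe_mk, Fin.prod_univ_two, torusProj,
    Matrix.cons_val_zero, Matrix.cons_val_one, squareMonomial]
  rw [fourier_coe_apply, fourier_coe_apply, ← Complex.exp_add]
  congr 1
  push_cast
  ring

/-- Trigonometric polynomials are dense in `L¹` of the period square. -/
theorem exists_mem_span_squareMonomial_integral_sub_le {a : ℝ} (ha : 0 < a) {f : ℝ × ℝ → ℂ}
    (hf : IntegrableOn f (periodSquare a)) {ε : ℝ} (hε : 0 < ε) :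
    ∃ t ∈ Submodule.span ℂ (range (squareMonomial a)),
      ∫ x in periodSquare a, ‖f x - t x‖ ≤ ε := by
  set ν := (volume : Measure (ℝ × ℝ)).restrict (periodSquare a) with hν
  have hQ := measurableSet_periodSquare a
  have hfin : IsFiniteMeasure ν := ⟨by
    rw [hν, Measure.restrict_apply_univ]; exact volume_periodSquare_lt_top a⟩
  have hπm : Measurable (torusProj a) := (continuous_torusProj a).measurable
  have hσm := measurable_torusSection a
  set μ := ν.map (torusProj a) with hμ
  have hμfin : IsFiniteMeasure μ := Measure.isFiniteMeasure_map ν _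
  have hid : torusSection a ∘ torusProj a =ᵐ[ν] id := by
    rw [hν]
    filter_upwards [ae_restrict_mem hQ] with x hx
    exact torusSection_torusProj ha hx
  have hμσ : μ.map (torusSection a) = ν := by
    rw [hμ, Measure.map_map hσm hπm, Measure.map_congr hid, Measure.map_id]
  -- The approximation by a continuous function is made on the torus, so that it is periodic from
  -- the start. Density of the characters among continuous functions on the torus then gives a
  -- uniform approximation.
  have hF : Integrable (f ∘ torusSection a) μ := by
    refine (integrable_map_measure ?_ hσm.aemeasurable).1 ?_
    · rw [hμσ]; exact hf.aestronglyMeasurable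
    · rw [hμσ]; exact hf
  obtain ⟨g, hg, hgi⟩ := hF.exists_boundedContinuous_integral_sub_le (half_pos hε)
  set V := ν.real univ
  have hV : 0 ≤ V := measureReal_nonneg
  -- `V + 1` replaces `V` so that the divisor is visibly positive.
  have hδ : 0 < ε / 2 / (V + 1) := by positivity
  have hmem : g.toContinuousMap ∈
      (Submodule.span ℂ (range (UnitAddTorus.mFourier (d := Fin 2)))).topologicalClosure := by
    rw [UnitAddTorus.span_mFourier_closure_eq_top]; trivial
  obtain ⟨p, hp, hgp⟩ := Metric.mem_closure_iff.1 hmem _ hδ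
  have hspan : (fun x => p (torusProj a x)) ∈ Submodule.span ℂ (range (squareMonomial a)) := by
    clear hgp
    induction hp using Submodule.span_induction with
    | mem p h =>
      obtain ⟨n, rfl⟩ := h
      exact Submodule.subset_span ⟨(n 0, n 1), funext fun x => (mFourier_torusProj a n x).symm⟩
    | zero => exact Submodule.zero_mem _
    | add p q _ _ hp hq => exact Submodule.add_mem _ hp hq
    | smul c p _ hp => exact Submodule.smul_mem _ c hp
  refine ⟨_, hspan, ?_⟩
  have hgπ : Continuous fun x => g (torusProj a x) := g.continuous.comp (continuous_torusProj a)
  have hpπ : Continuous fun x => p (torusProj a x) := p.continuous.comp (continuous_torusProj a)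
  have hig : Integrable (fun x => g (torusProj a x)) ν := hgπ.integrableOn_periodSquare a
  have hip : Integrable (fun x => p (torusProj a x)) ν := hpπ.integrableOn_periodSquare a
  have h1 : ∫ x, ‖f x - g (torusProj a x)‖ ∂ν ≤ ε / 2 := by
    refine le_trans (le_of_eq ?_) hg
    rw [hμ, integral_map hπm.aemeasurable (by
      exact (hF.sub hgi).aestronglyMeasurable.norm)]
    refine MeasureTheory.integral_congr_ae ?_
    filter_upwards [hid] with x hx
    simp only [Function.comp_apply, id] at hx ⊢
    rw [hx]
  have h2 : ∀ x, ‖g (torusProj a x) - p (torusProj a x)‖ ≤ ε / 2 / (V + 1) := fun x => by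
    rw [← dist_eq_norm]
    exact (ContinuousMap.dist_apply_le_dist (f := g.toContinuousMap) (g := p) _).trans hgp.le
  have h3 : ∫ x, ‖g (torusProj a x) - p (torusProj a x)‖ ∂ν ≤ ε / 2 := by
    calc ∫ x, ‖g (torusProj a x) - p (torusProj a x)‖ ∂ν
        ≤ ∫ _, ε / 2 / (V + 1) ∂ν :=
          integral_mono (hig.sub hip).norm (integrable_const _) h2
      _ = V * (ε / 2 / (V + 1)) := by rw [MeasureTheory.integral_const, smul_eq_mul]
      _ ≤ (V + 1) * (ε / 2 / (V + 1)) := by gcongr; linarith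
      _ = ε / 2 := by field_simp
  calc ∫ x, ‖f x - p (torusProj a x)‖ ∂ν
      ≤ ∫ x, (‖f x - g (torusProj a x)‖ + ‖g (torusProj a x) - p (torusProj a x)‖) ∂ν := by
        refine integral_mono (hf.sub hip).norm ((hf.sub hig).norm.add (hig.sub hip).norm)
          fun x => ?_
        exact norm_sub_le_norm_sub_add_norm_sub _ _ _
    _ = (∫ x, ‖f x - g (torusProj a x)‖ ∂ν) +
        ∫ x, ‖g (torusProj a x) - p (torusProj a x)‖ ∂ν :=
      MeasureTheory.integral_add (hf.sub hig).norm (hig.sub hip).norm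
    _ ≤ ε := by linarith

/-! ### Orthogonality and Bessel's inequality. -/

section orthogonality

variable {a : ℝ}

theorem integral_exp_symm_interval (ha : 0 < a) (k : ℤ) :
    ∫ t in (-a)..a, Complex.exp (Complex.I * k * (π / a * t : ℝ)) =
      if k = 0 then (2 * a : ℂ) else 0 := by
  have h := intervalIntegral.integral_comp_mul_left (a := -a) (b := a) (c := π / a)
    (fun t : ℝ => Complex.exp (Complex.I * k * t)) (by positivity)
  have h2 := integral_exp_int_mul k (-π)
  rw [show -π + 2 * π = π by ring] at h2
  rw [h, show π / a * -a = -π by field_simp, show π / a * a = π by field_simp, h2]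
  have hπ : (π : ℂ) ≠ 0 := by exact_mod_cast pi_ne_zero
  split_ifs
  · rw [Complex.real_smul]; push_cast; field_simp
  · simp

theorem setIntegral_squareMonomial (ha : 0 < a) (k : ℤ × ℤ) :
    ∫ x in periodSquare a, squareMonomial a k x = if k = 0 then (4 * a ^ 2 : ℂ) else 0 := by
  have e : ∀ x : ℝ × ℝ, squareMonomial a k x =
      Complex.exp (Complex.I * k.1 * (π / a * x.1 : ℝ)) *
      Complex.exp (Complex.I * k.2 * (π / a * x.2 : ℝ)) := fun x => by
    rw [squareMonomial, ← Complex.exp_add]; congr 1; push_cast; ring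
  simp_rw [e]
  rw [periodSquare, Measure.volume_eq_prod, setIntegral_prod_mul
    (fun t : ℝ => Complex.exp (Complex.I * k.1 * (π / a * t : ℝ)))
    (fun t : ℝ => Complex.exp (Complex.I * k.2 * (π / a * t : ℝ))),
    ← integral_of_le (by linarith), ← integral_of_le (by linarith),
    integral_exp_symm_interval ha, integral_exp_symm_interval ha]
  by_cases h1 : k.1 = 0 <;> by_cases h2 : k.2 = 0 <;> simp [h1, h2, Prod.ext_iff]
  ring

theorem setIntegral_squareMonomial_mul_neg (ha : 0 < a) (k l : ℤ × ℤ) :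
    ∫ x in periodSquare a, squareMonomial a k x * squareMonomial a (-l) x =
      if k = l then (4 * a ^ 2 : ℂ) else 0 := by
  simp_rw [← squareMonomial_add]
  rw [setIntegral_squareMonomial ha]
  simp only [← sub_eq_add_neg, sub_eq_zero]

theorem conj_squareMonomial (a : ℝ) (k : ℤ × ℤ) (x : ℝ × ℝ) :
    starRingEnd ℂ (squareMonomial a k x) = squareMonomial a (-k) x := by
  simp only [squareMonomial, ← Complex.exp_conj]
  congr 1
  simp
  ring

/-- Bessel's inequality on the period square. -/
theorem summable_sq_norm_setIntegral_mul_squareMonomial (ha : 0 < a) {h : ℝ × ℝ → ℂ}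
    (hh : MemLp h 2 (volume.restrict (periodSquare a))) :
    Summable fun k : ℤ × ℤ =>
      ‖∫ x in periodSquare a, h x * squareMonomial a (-k) x‖ ^ 2 := by
  set ν := (volume : Measure (ℝ × ℝ)).restrict (periodSquare a) with hν
  have hfin : IsFiniteMeasure ν := ⟨by
    rw [hν, Measure.restrict_apply_univ]; exact volume_periodSquare_lt_top a⟩
  have hmem : ∀ k, MemLp (fun x => (2 * a : ℂ)⁻¹ * squareMonomial a k x) 2 ν := fun k =>
    MemLp.of_bound (continuous_const.mul (continuous_squareMonomial a k)).aestronglyMeasurable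
      ‖(2 * a : ℂ)⁻¹‖ (.of_forall fun x => by rw [norm_mul, norm_squareMonomial, mul_one])
  have ha0 : (a : ℂ) ≠ 0 := by exact_mod_cast ha.ne'
  have hconj : ∀ (k : ℤ × ℤ) (x : ℝ × ℝ),
      starRingEnd ℂ ((2 * a : ℂ)⁻¹ * squareMonomial a k x) =
      (2 * a : ℂ)⁻¹ * squareMonomial a (-k) x := fun k x => by
    rw [map_mul, conj_squareMonomial, map_inv₀, map_mul, Complex.conj_ofReal,
      Complex.conj_ofNat]
  set e : ℤ × ℤ → Lp ℂ 2 ν := fun k => (hmem k).toLp _ with he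
  have hinner : ∀ (k : ℤ × ℤ) (u : ℝ × ℝ → ℂ) (hu : MemLp u 2 ν), inner ℂ (e k) (hu.toLp u) =
      (2 * a : ℂ)⁻¹ * ∫ x, u x * squareMonomial a (-k) x ∂ν := by
    intro k u hu
    rw [L2.inner_def, ← MeasureTheory.integral_const_mul]
    refine MeasureTheory.integral_congr_ae ?_
    filter_upwards [(hmem k).coeFn_toLp, hu.coeFn_toLp] with x h1 h2
    rw [h1, h2, RCLike.inner_apply, hconj]
    ring
  have horth : Orthonormal ℂ e := by
    -- The period square has area `4 a ^ 2`, hence the normalization by `(2 a)⁻¹`.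
    rw [orthonormal_iff_ite]
    intro k l
    rw [he, ← he, hinner k _ (hmem l)]
    simp_rw [mul_assoc]
    rw [MeasureTheory.integral_const_mul, setIntegral_squareMonomial_mul_neg ha]
    by_cases hkl : l = k
    · rw [if_pos hkl, if_pos hkl.symm]; field_simp; norm_num
    · rw [if_neg hkl, if_neg (Ne.symm hkl)]; simp
  have hs := horth.inner_products_summable (x := hh.toLp h)
  simp_rw [hinner _ h hh, norm_mul, mul_pow] at hs
  refine (summable_mul_left_iff ?_).1 hs
  have : ‖(2 * a : ℂ)⁻¹‖ ≠ 0 := norm_ne_zero_iff.2 (inv_ne_zero (mul_ne_zero two_ne_zero ha0))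
  positivity

end orthogonality

/-! ### Pairing with the partial sums: passage to the limit. -/

/-- The closed disk meets the edges excluded from the half-open square, but these lie in null lines.
-/
theorem disk_ae_le_periodSquare {a : ℝ} (ha : 0 < a) :
    (disk a : Set (ℝ × ℝ)) ≤ᵐ[volume] periodSquare a := by
  have h1 : ∀ᵐ z : ℝ × ℝ, z.1 ≠ -a :=
    Measure.quasiMeasurePreserving_fst.ae (Measure.ae_ne volume (-a))
  have h2 : ∀ᵐ z : ℝ × ℝ, z.2 ≠ -a :=
    Measure.quasiMeasurePreserving_snd.ae (Measure.ae_ne volume (-a))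
  filter_upwards [h1, h2] with z hz1 hz2 hz
  obtain ⟨h3, h4⟩ := disk_subset_Icc ha.le hz
  exact ⟨⟨lt_of_le_of_ne h3.1 hz1.symm, h3.2⟩, lt_of_le_of_ne h4.1 hz2.symm, h4.2⟩

theorem disk_half_subset_periodSquare {a : ℝ} (ha : 0 < a) : disk (a / 2) ⊆ periodSquare a := by
  intro z hz
  obtain ⟨h3, h4⟩ := disk_subset_Icc (by linarith) hz
  exact ⟨⟨by linarith [h3.1], by linarith [h3.2]⟩, by linarith [h4.1], by linarith [h4.2]⟩

section partialSums

variable {a : ℝ} {n : ℕ} {m : ℤ}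

/-- The square partial sum of the Fourier series of the cut-off Fourier–Zernike function. -/
noncomputable def zernikePartialSum (a : ℝ) (n : ℕ) (m : ℤ) (N : ℕ) (x : ℝ × ℝ) : ℂ :=
  ∑ k ∈ latticeSquare N, convFactor a k n m * squareMonomial a (-k) x

theorem continuous_zernikePartialSum (a : ℝ) (n : ℕ) (m : ℤ) (N : ℕ) :
    Continuous (zernikePartialSum a n m N) :=
  continuous_finsetSum _ fun k _ => continuous_const.mul (continuous_squareMonomial a (-k))

theorem monotone_latticeSquare : Monotone latticeSquare := fun M N h => by
  have h' : (M : ℤ) ≤ N := by exact_mod_cast h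
  exact Finset.product_subset_product (Finset.Icc_subset_Icc (by omega) h')
    (Finset.Icc_subset_Icc (by omega) h')

theorem exists_mem_latticeSquare (k : ℤ × ℤ) : ∃ N, k ∈ latticeSquare N := by
  refine ⟨k.1.natAbs + k.2.natAbs, ?_⟩
  simp only [latticeSquare, Finset.mem_product, Finset.mem_Icc, Nat.cast_add]
  omega

theorem tendsto_latticeSquare : Filter.Tendsto latticeSquare Filter.atTop Filter.atTop :=
  Filter.tendsto_atTop_finset_of_monotone monotone_latticeSquare exists_mem_latticeSquare

/-- For a monomial of frequency `k`, orthogonality leaves the single term of index `k` once the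
square contains `k`. The property passes to linear combinations. -/
theorem eventually_setIntegral_mul_zernikePartialSum (ha : 0 < a) (hmn : m.natAbs ≤ n)
    (hpar : n ≡ m.natAbs [MOD 2]) {t : ℝ × ℝ → ℂ}
    (ht : t ∈ Submodule.span ℂ (range (squareMonomial a))) :
    ∀ᶠ N in Filter.atTop,
      ∫ x in periodSquare a, t x * zernikePartialSum a n m N x = zernikeCoeff a n m t := by
  obtain ⟨P, hP⟩ := exists_mvPolynomial_eval_eq_conj_fourierZernike a hmn hpar
  have hZ : ∀ {u : ℝ × ℝ → ℂ}, Continuous u → zernikeCoeff a n m u =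
      ∫ z in disk a, u z * MvPolynomial.eval ![(z.1 : ℂ), (z.2 : ℂ)] P := fun hu =>
    zernikeCoeff_eq_setIntegral ha hP (hu.integrableOn_disk ha.le)
  have hGi : ∀ {u : ℝ × ℝ → ℂ}, Continuous u → IntegrableOn
      (fun z : ℝ × ℝ => u z * MvPolynomial.eval ![(z.1 : ℂ), (z.2 : ℂ)] P) (disk a) := fun hu =>
    (hu.mul (continuous_eval_pair P)).integrableOn_disk ha.le
  have hTi : ∀ {u : ℝ × ℝ → ℂ}, Continuous u → ∀ N, IntegrableOn
      (fun z : ℝ × ℝ => u z * zernikePartialSum a n m N z) (periodSquare a) := fun hu N =>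
    (hu.mul (continuous_zernikePartialSum a n m N)).integrableOn_periodSquare a
  induction ht using Submodule.span_induction with
  | mem t h =>
    obtain ⟨k, rfl⟩ := h
    obtain ⟨M, hM⟩ := exists_mem_latticeSquare k
    filter_upwards [Filter.eventually_ge_atTop M] with N hN
    rw [zernikeCoeff_squareMonomial ha k hmn hpar]
    simp only [zernikePartialSum, Finset.mul_sum]
    rw [MeasureTheory.integral_finsetSum]
    · have e : ∀ l x, squareMonomial a k x * (convFactor a l n m * squareMonomial a (-l) x) =
          convFactor a l n m * (squareMonomial a k x * squareMonomial a (-l) x) := fun l x => by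
        ring
      simp_rw [e, MeasureTheory.integral_const_mul, setIntegral_squareMonomial_mul_neg ha]
      rw [Finset.sum_eq_single k]
      · rw [if_pos rfl, mul_comm]
      · intro l _ hl; rw [if_neg hl.symm, mul_zero]
      · intro h; exact absurd (monotone_latticeSquare hN hM) h
    · intro l _
      exact ((continuous_squareMonomial a k).mul (continuous_const.mul
        (continuous_squareMonomial a (-l)))).integrableOn_periodSquare a
  | zero => simp [zernikeCoeff]
  | add t u ht' hu' ht hu =>
    have hct := continuous_of_mem_span_squareMonomial ht'
    have hcu := continuous_of_mem_span_squareMonomial hu'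
    filter_upwards [ht, hu] with N h1 h2
    rw [hZ hct] at h1
    rw [hZ hcu] at h2
    rw [hZ (hct.add hcu)]
    simp only [Pi.add_apply, add_mul]
    rw [MeasureTheory.integral_add (hTi hct N) (hTi hcu N),
      MeasureTheory.integral_add (hGi hct) (hGi hcu), h1, h2]
  | smul c t ht' ht =>
    have hct := continuous_of_mem_span_squareMonomial ht'
    filter_upwards [ht] with N h1
    rw [hZ hct] at h1
    rw [hZ (hct.const_smul c)]
    simp only [Pi.smul_apply, smul_eq_mul, mul_assoc]
    rw [MeasureTheory.integral_const_mul, MeasureTheory.integral_const_mul, h1]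

/-- Integrating an integrable function against the square partial sums of the cut-off
Fourier–Zernike function yields its Fourier–Zernike coefficient in the limit. -/
theorem tendsto_setIntegral_mul_zernikePartialSum (ha : 0 < a) (hmn : m.natAbs ≤ n)
    (hpar : n ≡ m.natAbs [MOD 2]) {f : ℝ × ℝ → ℂ} (hf : IntegrableOn f (periodSquare a)) :
    Filter.Tendsto (fun N => ∫ x in periodSquare a, f x * zernikePartialSum a n m N x)
      Filter.atTop (nhds (zernikeCoeff a n m f)) := by
  obtain ⟨P, hP⟩ := exists_mvPolynomial_eval_eq_conj_fourierZernike a hmn hpar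
  obtain ⟨C, hC⟩ := exists_norm_sum_convFactor_le ha hmn hpar
  obtain ⟨M, hM⟩ := (isCompact_disk ha.le).exists_bound_of_continuousOn
    (continuous_eval_pair P).continuousOn
  have hC0 : 0 ≤ C := (norm_nonneg _).trans (hC 0 (0, 0) (by simpa using ha.le)
    (by simpa using ha.le))
  have hM0 : 0 ≤ M := (norm_nonneg _).trans (hM (0, 0) (by simp [disk]; positivity))
  have hDQ := disk_ae_le_periodSquare ha
  have hfD : IntegrableOn f (disk a) := hf.mono_set_ae hDQ
  have hTb : ∀ N, ∀ x ∈ periodSquare a, ‖zernikePartialSum a n m N x‖ ≤ C := fun N x hx =>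
    hC N x (abs_le.2 ⟨hx.1.1.le, hx.1.2⟩) (abs_le.2 ⟨hx.2.1.le, hx.2.2⟩)
  rw [Metric.tendsto_nhds]
  intro ε hε
  -- `C` bounds the partial sums and `M` the polynomial on the disk, so replacing `f` by a
  -- trigonometric polynomial costs at most `(C + M) δ` in total. The term `1` keeps the divisor
  -- positive.
  set δ := ε / (2 * (C + M + 1)) with hδ
  have hδ0 : 0 < δ := by positivity
  obtain ⟨t, ht, htf⟩ := exists_mem_span_squareMonomial_integral_sub_le ha hf hδ0
  have htc := continuous_of_mem_span_squareMonomial ht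
  have htQ : IntegrableOn t (periodSquare a) := htc.integrableOn_periodSquare a
  filter_upwards [eventually_setIntegral_mul_zernikePartialSum ha hmn hpar ht] with N hN
  have hT := continuous_zernikePartialSum a n m N
  have hQ := measurableSet_periodSquare a
  have hmulT : ∀ {u : ℝ × ℝ → ℂ}, IntegrableOn u (periodSquare a) →
      IntegrableOn (fun x => u x * zernikePartialSum a n m N x) (periodSquare a) := fun hu =>
    Integrable.mul_bdd (c := C) hu hT.aestronglyMeasurable
      ((ae_restrict_iff' hQ).2 (.of_forall fun x hx => hTb N x hx))
  have hmulG : ∀ {u : ℝ × ℝ → ℂ}, IntegrableOn u (disk a) → IntegrableOn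
      (fun z : ℝ × ℝ => u z * MvPolynomial.eval ![(z.1 : ℂ), (z.2 : ℂ)] P) (disk a) := fun hu =>
    hu.mul_continuousOn (continuous_eval_pair P).continuousOn (isCompact_disk ha.le)
  have htD : IntegrableOn t (disk a) := htc.integrableOn_disk ha.le
  have e1 : (∫ x in periodSquare a, f x * zernikePartialSum a n m N x) -
      ∫ x in periodSquare a, t x * zernikePartialSum a n m N x =
      ∫ x in periodSquare a, (f x - t x) * zernikePartialSum a n m N x := by
    rw [← MeasureTheory.integral_sub (hmulT hf) (hmulT htQ)]
    simp_rw [sub_mul]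
  have e2 : zernikeCoeff a n m f - zernikeCoeff a n m t =
      ∫ z in disk a, (f z - t z) * MvPolynomial.eval ![(z.1 : ℂ), (z.2 : ℂ)] P := by
    rw [zernikeCoeff_eq_setIntegral ha hP hfD, zernikeCoeff_eq_setIntegral ha hP htD,
      ← MeasureTheory.integral_sub (hmulG hfD) (hmulG htD)]
    simp_rw [sub_mul]
  have hfn : IntegrableOn (fun x => ‖f x - t x‖) (periodSquare a) := (hf.sub htQ).norm
  have b1 : ‖∫ x in periodSquare a, (f x - t x) * zernikePartialSum a n m N x‖ ≤ C * δ := by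
    refine (MeasureTheory.norm_integral_le_of_norm_le (hfn.const_mul C)
      ((ae_restrict_iff' hQ).2 (.of_forall fun x hx => ?_))).trans ?_
    · rw [norm_mul, mul_comm]
      exact mul_le_mul_of_nonneg_right (hTb N x hx) (norm_nonneg _)
    · rw [MeasureTheory.integral_const_mul]
      exact mul_le_mul_of_nonneg_left htf hC0
  have b2 : ‖∫ z in disk a, (f z - t z) * MvPolynomial.eval ![(z.1 : ℂ), (z.2 : ℂ)] P‖
      ≤ M * δ := by
    refine (MeasureTheory.norm_integral_le_of_norm_le ((hfn.mono_set_ae hDQ).const_mul M)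
      ((ae_restrict_iff' (measurableSet_disk a)).2 (.of_forall fun x hx => ?_))).trans ?_
    · rw [norm_mul, mul_comm]
      exact mul_le_mul_of_nonneg_right (hM x hx) (norm_nonneg _)
    · rw [MeasureTheory.integral_const_mul]
      refine mul_le_mul_of_nonneg_left (le_trans ?_ htf) hM0
      exact setIntegral_mono_set hfn (.of_forall fun x => norm_nonneg _) hDQ
  rw [dist_eq_norm]
  have e3 : (∫ x in periodSquare a, f x * zernikePartialSum a n m N x) - zernikeCoeff a n m f =
      (∫ x in periodSquare a, (f x - t x) * zernikePartialSum a n m N x) -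
      ∫ z in disk a, (f z - t z) * MvPolynomial.eval ![(z.1 : ℂ), (z.2 : ℂ)] P := by
    rw [← e1, ← e2, hN]; ring
  rw [e3]
  refine (norm_sub_le _ _).trans_lt ?_
  have : (C + M) * δ < ε := by
    rw [hδ, mul_div_assoc', div_lt_iff₀ (by positivity)]
    nlinarith
  linarith

end partialSums

/-! ### The convolution and its Fourier coefficients. -/

section convolution

variable {a : ℝ} {f₁ f₂ : ℝ × ℝ → ℂ}

/-- By the parallelogram law, `t` and `x - t` in the disk of radius `a / 2` force `x` into the disk
of radius `a`. The vanishing holds at every such `x`, since translation and reflection preserve null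
sets. -/
theorem planeConv_eq_zero (hs₁ : ∀ᵐ x : ℝ × ℝ, x ∉ disk (a / 2) → f₁ x = 0)
    (hs₂ : ∀ᵐ x : ℝ × ℝ, x ∉ disk (a / 2) → f₂ x = 0) {x : ℝ × ℝ} (hx : x ∉ disk a) :
    planeConv f₁ f₂ x = 0 := by
  rw [planeConv, convolution_def]
  refine integral_eq_zero_of_ae ?_
  have h2 : ∀ᵐ t : ℝ × ℝ, x - t ∉ disk (a / 2) → f₂ (x - t) = 0 :=
    (quasiMeasurePreserving_sub_left_of_right_invariant volume x).ae hs₂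
  filter_upwards [hs₁, h2] with t h1 h2
  simp only [ContinuousLinearMap.mul_apply', Pi.zero_apply]
  by_cases ht : t ∈ disk (a / 2)
  · rw [h2 fun hxt => hx ?_, mul_zero]
    simp only [disk, mem_ofPred_eq, Prod.fst_sub, Prod.snd_sub] at ht hxt ⊢
    nlinarith [sq_nonneg (x.1 - 2 * t.1), sq_nonneg (x.2 - 2 * t.2)]
  · rw [h1 ht, zero_mul]

theorem integrable_mul_squareMonomial {f : ℝ × ℝ → ℂ} (hf : Integrable f) (k : ℤ × ℤ) :
    Integrable fun x => f x * squareMonomial a k x :=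
  Integrable.mul_bdd (c := 1) hf (continuous_squareMonomial a k).aestronglyMeasurable
    (.of_forall fun x => (norm_squareMonomial a k x).le)

theorem squareFourierCoeff_eq_integral (ha : 0 < a) {f : ℝ × ℝ → ℂ} (hf : Integrable f)
    (hs : ∀ᵐ x : ℝ × ℝ, x ∉ disk (a / 2) → f x = 0) (k : ℤ × ℤ) :
    squareFourierCoeff a f k = ∫ x, f x * squareMonomial a (-k) x := by
  have hi := integrable_mul_squareMonomial (a := a) hf (-k)
  have h1 : ∫ x in periodSquare a, f x * squareMonomial a (-k) x =
      ∫ x, f x * squareMonomial a (-k) x := by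
    refine setIntegral_eq_integral_of_ae_compl_eq_zero ?_
    filter_upwards [hs] with x hx hxQ
    rw [hx fun h => hxQ (disk_half_subset_periodSquare ha h), zero_mul]
  rw [← h1, periodSquare, Measure.volume_eq_prod, ← Measure.prod_restrict, integral_prod_symm,
    squareFourierCoeff, integral_of_le (by linarith)]
  · refine setIntegral_congr_fun measurableSet_Ioc fun x₂ _ => ?_
    rw [integral_of_le (by linarith)]
    refine setIntegral_congr_fun measurableSet_Ioc fun x₁ _ => ?_
    simp only [squareMonomial]
    congr 2
    push_cast [Prod.fst_neg, Prod.snd_neg]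
    ring
  · rw [Measure.prod_restrict]
    exact hi.integrableOn

theorem integrable_planeConv (hf₁ : Integrable f₁) (hf₂ : Integrable f₂) :
    Integrable (planeConv f₁ f₂) :=
  hf₁.integrable_convolution _ hf₂

/-- A monomial is a character: multiplying `f₁ ∗ f₂` by it is convolving the products, and the
integral of a convolution is the product of the integrals. -/
theorem integral_planeConv_mul_squareMonomial (hf₁ : Integrable f₁) (hf₂ : Integrable f₂)
    (k : ℤ × ℤ) :
    ∫ x, planeConv f₁ f₂ x * squareMonomial a k x =
      (∫ x, f₁ x * squareMonomial a k x) * ∫ x, f₂ x * squareMonomial a k x := by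
  have h := integral_convolution (ContinuousLinearMap.mul ℝ ℂ)
    (integrable_mul_squareMonomial (a := a) hf₁ k) (integrable_mul_squareMonomial (a := a) hf₂ k)
  rw [ContinuousLinearMap.mul_apply'] at h
  rw [← h]
  congr 1
  funext x
  rw [planeConv, convolution_def, convolution_def, ← MeasureTheory.integral_mul_const]
  congr 1
  funext t
  have : squareMonomial a k x = squareMonomial a k t * squareMonomial a k (x - t) := by
    simp only [squareMonomial, ← Complex.exp_add, Prod.fst_sub, Prod.snd_sub]
    push_cast; ring_nf
  simp only [ContinuousLinearMap.mul_apply', this]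
  ring

end convolution

/-! ### Absolute convergence and the conclusion. -/

/-- The factors are, up to `4 a ^ 2` and the sign of `k`, the Fourier coefficients of a bounded
function on the square. Bessel's inequality applies to it and to `f`, and a product of two square
summable sequences is summable. -/
theorem summable_convFactor_mul {a : ℝ} (ha : 0 < a) {n : ℕ} {m : ℤ} (hmn : m.natAbs ≤ n)
    (hpar : n ≡ m.natAbs [MOD 2]) {f : ℝ × ℝ → ℂ} (hf : MemLp f 2 volume) :
    Summable fun k : ℤ × ℤ =>
      convFactor a k n m * ∫ x in periodSquare a, f x * squareMonomial a (-k) x := by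
  obtain ⟨P, hP⟩ := exists_mvPolynomial_eval_eq_conj_fourierZernike a hmn hpar
  have h1 := summable_sq_norm_setIntegral_mul_squareMonomial ha (hf.restrict (periodSquare a))
  obtain ⟨M, hM⟩ := (isCompact_disk ha.le).exists_bound_of_continuousOn
    (continuous_eval_pair P).continuousOn
  have hD := measurableSet_disk a
  set g : ℝ × ℝ → ℂ := (disk a).indicator
    fun z => MvPolynomial.eval ![(z.1 : ℂ), (z.2 : ℂ)] P with hg
  have hfin : IsFiniteMeasure ((volume : Measure (ℝ × ℝ)).restrict (periodSquare a)) := ⟨by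
    rw [Measure.restrict_apply_univ]; exact volume_periodSquare_lt_top a⟩
  have hM0 : 0 ≤ M := (norm_nonneg _).trans (hM (0, 0) (by simp [disk]; positivity))
  have hgL : MemLp g 2 (volume.restrict (periodSquare a)) :=
    MemLp.of_bound ((continuous_eval_pair P).aestronglyMeasurable.indicator hD) M
      (.of_forall fun z => by
        by_cases hz : z ∈ disk a
        · rw [hg, indicator_of_mem hz]; exact hM z hz
        · rw [hg, indicator_of_notMem hz, norm_zero]; exact hM0)
  have h2 := summable_sq_norm_setIntegral_mul_squareMonomial ha hgL
  have hcoef : ∀ k : ℤ × ℤ, ∫ x in periodSquare a, g x * squareMonomial a k x =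
      4 * a ^ 2 * convFactor a k n m := fun k => by
    rw [← setIntegral_squareMonomial_mul_eval ha hmn hpar hP]
    have e : ∀ x, g x * squareMonomial a k x = (disk a).indicator (fun z =>
        squareMonomial a k z * MvPolynomial.eval ![(z.1 : ℂ), (z.2 : ℂ)] P) x := fun x => by
      by_cases hx : x ∈ disk a
      · rw [hg, indicator_of_mem hx, indicator_of_mem hx, mul_comm]
      · rw [hg, indicator_of_notMem hx, indicator_of_notMem hx, zero_mul]
    simp_rw [e]
    rw [setIntegral_indicator hD]
    refine setIntegral_congr_set ?_
    filter_upwards [disk_ae_le_periodSquare ha] with z hz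
    exact propext ⟨fun h => h.2, fun h => ⟨hz h, h⟩⟩
  have h3 : Summable fun k : ℤ × ℤ => ‖(4 * a ^ 2 : ℂ) * convFactor a k n m‖ ^ 2 := by
    refine ((Equiv.neg (ℤ × ℤ)).summable_iff.2 h2).congr fun k => ?_
    simp only [Function.comp_apply, Equiv.neg_apply, neg_neg, hcoef]
  have hc0 : ‖(4 * a ^ 2 : ℂ)‖ ^ 2 ≠ 0 := by
    have ha0 : (a : ℂ) ≠ 0 := by exact_mod_cast ha.ne'
    have : (4 * a ^ 2 : ℂ) ≠ 0 := mul_ne_zero (by norm_num) (pow_ne_zero 2 ha0)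
    exact pow_ne_zero 2 (norm_ne_zero_iff.2 this)
  simp_rw [norm_mul _ (convFactor a _ n m), mul_pow] at h3
  refine Summable.of_norm_bounded (((summable_mul_left_iff hc0).1 h3).add h1) fun k => ?_
  rw [norm_mul]
  nlinarith [sq_nonneg (‖convFactor a k n m‖ -
    ‖∫ x in periodSquare a, f x * squareMonomial a (-k) x‖),
    mul_nonneg (norm_nonneg (convFactor a k n m))
    (norm_nonneg (∫ x in periodSquare a, f x * squareMonomial a (-k) x))]

/-- For integrable `f₁, f₂` the series over `ℤ²` need not converge absolutely: it is the limit of its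
square partial sums. It converges absolutely as soon as `f₁ ∗ f₂` is square integrable. -/
theorem mainTheorem1 (a : ℝ) (ha : 0 < a) (f₁ f₂ : ℝ × ℝ → ℂ)
    (hf₁ : MeasureTheory.Integrable f₁ MeasureTheory.volume)
    (hf₂ : MeasureTheory.Integrable f₂ MeasureTheory.volume)
    (hs₁ : ∀ᵐ x ∂(MeasureTheory.volume : MeasureTheory.Measure (ℝ × ℝ)),
      x ∉ disk (a / 2) → f₁ x = 0)
    (hs₂ : ∀ᵐ x ∂(MeasureTheory.volume : MeasureTheory.Measure (ℝ × ℝ)),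
      x ∉ disk (a / 2) → f₂ x = 0)
    (n : ℕ) (m : ℤ) (hmn : m.natAbs ≤ n) (hpar : n ≡ m.natAbs [MOD 2]) :
    Filter.Tendsto
      (fun N : ℕ => ∑ k ∈ latticeSquare N,
        convFactor a k n m * squareFourierCoeff a f₁ k * squareFourierCoeff a f₂ k)
      Filter.atTop (nhds (zernikeCoeff a n m (planeConv f₁ f₂))) ∧
    (MeasureTheory.MemLp (planeConv f₁ f₂) 2 MeasureTheory.volume →
      HasSum
        (fun k : ℤ × ℤ =>
          convFactor a k n m * squareFourierCoeff a f₁ k * squareFourierCoeff a f₂ k)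
        (zernikeCoeff a n m (planeConv f₁ f₂))) := by
  set f := planeConv f₁ f₂ with hf
  have hfi : Integrable f := integrable_planeConv hf₁ hf₂
  have hfQ : ∀ u : ℝ × ℝ → ℂ, ∫ x in periodSquare a, f x * u x = ∫ x, f x * u x := fun u => by
    refine setIntegral_eq_integral_of_ae_compl_eq_zero ?_
    filter_upwards [disk_ae_le_periodSquare ha] with x hx hxQ
    rw [hf, planeConv_eq_zero hs₁ hs₂ fun h => hxQ (hx h), zero_mul]
  have hterm : ∀ k : ℤ × ℤ,
      convFactor a k n m * squareFourierCoeff a f₁ k * squareFourierCoeff a f₂ k =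
      convFactor a k n m * ∫ x in periodSquare a, f x * squareMonomial a (-k) x := fun k => by
    rw [hfQ, integral_planeConv_mul_squareMonomial hf₁ hf₂,
      squareFourierCoeff_eq_integral ha hf₁ hs₁, squareFourierCoeff_eq_integral ha hf₂ hs₂,
      mul_assoc]
  have hlim : Filter.Tendsto (fun N : ℕ => ∑ k ∈ latticeSquare N,
      convFactor a k n m * squareFourierCoeff a f₁ k * squareFourierCoeff a f₂ k)
      Filter.atTop (nhds (zernikeCoeff a n m f)) := by
    refine (tendsto_setIntegral_mul_zernikePartialSum ha hmn hpar hfi.integrableOn).congr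
      fun N => ?_
    simp only [hterm, zernikePartialSum, Finset.mul_sum]
    rw [MeasureTheory.integral_finsetSum]
    · refine Finset.sum_congr rfl fun k _ => ?_
      rw [← MeasureTheory.integral_const_mul]
      congr 1; funext x; ring
    · intro k _
      refine (((integrable_mul_squareMonomial (a := a) hfi (-k)).const_mul
        (convFactor a k n m)).congr (.of_forall fun x => ?_)).integrableOn
      simp only
      ring
  refine ⟨hlim, fun hL2 => ?_⟩
  have hs := summable_convFactor_mul ha hmn hpar hL2
  simp_rw [← hterm] at hs
  -- The squares exhaust `ℤ × ℤ`, so the unconditional sum has the same value as the limit along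
  -- them.
  have := tendsto_nhds_unique hlim (hs.hasSum.comp tendsto_latticeSquare)
  rw [this]
  exact hs.hasSum
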